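/- A simple graph is planar if it can be drawn in the plane $\mathbb{R}^2$ with its vertices represented by distinct points and its edges by simple arcs between the points representing their end vertices, such that no arc contains a point representing a vertex other than its two ends and any two arcs meet at most in a common end point. A graph admits a plane straight-line embedding on a set $X \subseteq \mathbb{R}^2$ if it has such a drawing in which all edges are line segments and all vertices are represented by points of $X$. A set $X \subseteq \mathbb{R}^2$ is called $n$-universal if every planar graph with $n$ vertices admits a plane straight-line embedding on $X$. Let $f(n)$ be the minimum size of an $n$-universal set. Then $$f(n) \ge (1.059 - o(1))\,n \qquad \text{as } n \to \infty .$$ That is, there is a sequence of real numbers $\varepsilon_n \to 0$ such that $f(n) \ge (1.059 - \varepsilon_n)\, n$ for all $n$. -/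

import Mathlib

open Filter Topology

/-- The Euclidean plane `ℝ²`. -/
abbrev Plane : Type := EuclideanSpace ℝ (Fin 2)

/-- `A` is a simple (non-self-intersecting) arc in the plane with end points `x` and `y`. -/
def IsSimpleArc (A : Set Plane) (x y : Plane) : Prop :=
  ∃ γ : Path x y, Function.Injective γ ∧ Set.range γ = A

/-- A drawing of the graph `G` in the plane without crossings: the vertex `v` is represented by the
point `p v`, distinct vertices by distinct points, and the edge `uv` by the set `arc u v`, which is
a simple arc from `p u` to `p v`. An arc passes through no vertices other than its end points, and
arcs of distinct edges meet only in points that represent vertices (hence only in common end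
points). The values of `arc` on non-adjacent pairs play no role. -/
structure IsPlaneDrawing {V : Type*} (G : SimpleGraph V) (p : V → Plane)
    (arc : V → V → Set Plane) : Prop where
  injective : Function.Injective p
  arc_symm : ∀ u v, G.Adj u v → arc u v = arc v u
  isSimpleArc : ∀ u v, G.Adj u v → IsSimpleArc (arc u v) (p u) (p v)
  vertex_of_mem_arc : ∀ u v w, G.Adj u v → p w ∈ arc u v → w = u ∨ w = v
  noncrossing : ∀ u v w x, G.Adj u v → G.Adj w x → s(u, v) ≠ s(w, x) →
    arc u v ∩ arc w x ⊆ Set.range p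

/-- A graph is planar if it can be drawn in the plane without crossings
(edges being arbitrary simple arcs). -/
def IsPlanar {V : Type*} (G : SimpleGraph V) : Prop :=
  ∃ (p : V → Plane) (arc : V → V → Set Plane), IsPlaneDrawing G p arc

/-- `G` admits a plane straight-line embedding on the point set `X`: it has a drawing without
crossings in which every vertex is a point of `X` and every edge is a line segment. -/
def HasStraightLineEmbedding {V : Type*} (G : SimpleGraph V) (X : Set Plane) : Prop :=
  ∃ p : V → Plane, (∀ v, p v ∈ X) ∧ IsPlaneDrawing G p (fun u v => segment ℝ (p u) (p v))

/-- `X` is `n`-universal: every planar graph with `n` vertices admits a plane straight-line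
embedding on `X`. -/
def IsUniversalPointSet (n : ℕ) (X : Set Plane) : Prop :=
  ∀ G : SimpleGraph (Fin n), IsPlanar G → HasStraightLineEmbedding G X

/-- The minimum size `f(n)` of an `n`-universal point set. -/
noncomputable def minUniversalSize (n : ℕ) : ℕ∞ :=
  ⨅ (X : Set Plane) (_ : IsUniversalPointSet n X), X.encard

/-! Labelled planar graphs are counted against labelled placements. A stacked triangulation on `n =
k + 4` vertices arises from `K₄` by inserting the vertices `4, 5, …` one at a time into a face other
than the outer one, and is recorded by the list of chosen faces. There are at least `2 ^ k * k!`
such lists (`two_pow_mul_factorial_le_card_stackLists`), and each gives a planar graph: put every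
new vertex at the centroid of its triangle (`IsFaceDrawing.insert`).

An embedding on a set of `m` points is an injection `Fin n → X`, and the injection determines the
list (`IsStackDrawing.eq_of_length_eq`): by induction it determines the list without its last
insertion, and then the position of the last vertex determines the face that received it. Hence `2 ^
k * k! ≤ m (m - 1) ⋯ (m - n + 1)`, so `m.choose n` is at least `2 ^ n` up to a polynomial factor.
For `m ≤ 17 n / 16` it is at most `64 ^ (n / 16)`, exponentially smaller, and `17 / 16 > 1.059`.

The geometric core is `IsStackDrawing.exists_face`. It must cover every straight-line drawing,
whichever face is unbounded. Instead of topological faces it uses connected sets avoiding the edges: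
the vertices in the closure of such a set lie in one combinatorial face. Only the two sides of a
triangle are needed, not the Jordan curve theorem. -/

/-! ### Triangles in the plane -/

theorem mem_convexHull_triple {q a b c : Plane} :
    q ∈ convexHull ℝ ({a, b, c} : Set Plane) ↔ ∃ α β γ : ℝ, 0 ≤ α ∧ 0 ≤ β ∧ 0 ≤ γ ∧
      α + β + γ = 1 ∧ q = α • a + β • b + γ • c := by
  rw [convexHull_insert (by simp), convexHull_pair]
  simp only [convexJoin_singleton_left, Set.mem_iUnion, exists_prop]
  constructor
  · rintro ⟨y, ⟨s, t, hs, ht, hst, rfl⟩, ⟨u, v, hu, hv, huv, rfl⟩⟩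
    refine ⟨u, v * s, v * t, hu, by positivity, by positivity, ?_, by module⟩
    rw [add_assoc, ← mul_add, hst, mul_one, huv]
  · rintro ⟨α, β, γ, hα, hβ, hγ, h, rfl⟩
    rcases eq_or_lt_of_le (add_nonneg hβ hγ) with h0 | h0
    · refine ⟨b, left_mem_segment _ _ _, ?_⟩
      have h1 : β = 0 := by linarith
      have h2 : γ = 0 := by linarith
      have h3 : α = 1 := by linarith
      subst h1 h2 h3
      simpa using left_mem_segment ℝ a b
    · refine ⟨(β / (β + γ)) • b + (γ / (β + γ)) • c,
        ⟨_, _, by positivity, by positivity, by field_simp, rfl⟩,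
        α, β + γ, hα, h0.le, by linarith, ?_⟩
      rw [smul_add, smul_smul, smul_smul, mul_div_cancel₀ _ h0.ne', mul_div_cancel₀ _ h0.ne',
        add_assoc]

/-- A point in the hull of a triangle off the edges of that triangle is an interior point. -/
theorem frontier_convexHull_triple_subset {a b c : Plane}
    (h : ¬ Collinear ℝ ({a, b, c} : Set Plane)) :
    frontier (convexHull ℝ ({a, b, c} : Set Plane)) ⊆
      segment ℝ a b ∪ segment ℝ b c ∪ segment ℝ a c := by
  intro q hq
  have hcl : IsClosed (convexHull ℝ ({a, b, c} : Set Plane)) :=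
    (Set.toFinite _).isClosed_convexHull ℝ
  have hq' := hcl.frontier_subset hq
  have hind := affineIndependent_iff_not_collinear_set.2 h
  obtain ⟨α, β, γ, hα, hβ, hγ, hs, rfl⟩ := mem_convexHull_triple.1 hq'
  rcases eq_or_lt_of_le hα with rfl | hα
  · exact .inl (.inr ⟨β, γ, hβ, hγ, by linarith, by simp⟩)
  rcases eq_or_lt_of_le hβ with rfl | hβ
  · exact .inr ⟨α, γ, hα.le, hγ, by linarith, by simp⟩
  rcases eq_or_lt_of_le hγ with rfl | hγ
  · exact .inl (.inl ⟨α, β, hα.le, hβ.le, by linarith, by simp⟩)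
  exfalso
  have htop : affineSpan ℝ (Set.range ![a, b, c]) = ⊤ := by
    rw [hind.affineSpan_eq_top_iff_card_eq_finrank_add_one]
    simp
  let B : AffineBasis (Fin 3) ℝ Plane := ⟨![a, b, c], hind, htop⟩
  have hr : Set.range B = {a, b, c} := by
    change Set.range ![a, b, c] = _
    simp only [Matrix.range_cons, Matrix.range_empty]
    ext; simp; tauto
  refine hq.2 ?_
  have := B.interior_convexHull
  rw [hr] at this
  rw [this]
  have hcomb : α • a + β • b + γ • c
      = Finset.univ.affineCombination ℝ B ![α, β, γ] := by
    rw [Finset.affineCombination_eq_linear_combination _ _ _ (by simp [Fin.sum_univ_three, hs])]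
    simp only [Fin.sum_univ_three]
    rfl
  intro i
  rw [hcomb, B.coord_apply_combination_of_mem (Finset.mem_univ i)
    (by simp [Fin.sum_univ_three, hs])]
  fin_cases i <;> simpa

/-! ### Sides of triangles and plane drawings of `K₄` -/

/-- The straight-line drawing of the complete graph on the points of `K` has no crossings. -/
structure IsPlaneClique (K : Finset Plane) : Prop where
  eq_or_eq : ∀ u ∈ K, ∀ v ∈ K, ∀ w ∈ K, w ∈ segment ℝ u v → w = u ∨ w = v
  disjoint : ∀ u ∈ K, ∀ v ∈ K, ∀ w ∈ K, ∀ x ∈ K, u ≠ v → w ≠ x → u ≠ w → u ≠ x → v ≠ w → v ≠ x →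
    Disjoint (segment ℝ u v) (segment ℝ w x)

open Classical in
/-- The side of the triangle with vertex set `f` which does not contain `x`. -/
noncomputable def oppSide (x : Plane) (f : Set Plane) : Set Plane :=
  if x ∈ convexHull ℝ f then (convexHull ℝ f)ᶜ else interior (convexHull ℝ f)

theorem isOpen_oppSide (x : Plane) {f : Set Plane} (hf : f.Finite) : IsOpen (oppSide x f) := by
  unfold oppSide
  split_ifs
  · exact (hf.isClosed_convexHull ℝ).isOpen_compl
  · exact isOpen_interior

theorem frontier_oppSide_subset (x : Plane) (f : Set Plane) :
    frontier (oppSide x f) ⊆ frontier (convexHull ℝ f) := by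
  unfold oppSide
  split_ifs
  · rw [frontier_compl]
  · exact frontier_interior_subset

theorem notMem_closure_oppSide {x : Plane} {f : Set Plane} (hf : f.Finite)
    (hx : x ∉ frontier (convexHull ℝ f)) : x ∉ closure (oppSide x f) := by
  have hcl := hf.isClosed_convexHull ℝ
  unfold oppSide
  split_ifs with h
  · rw [closure_compl]
    exact not_not.2 (by_contra fun h' => hx ⟨subset_closure h, h'⟩)
  · exact fun h' => h (closure_minimal interior_subset hcl h')

/-- A triangle has only two sides: when `x` and `y` are separated by it, the side away from `x` is
the one containing `y`, up to the boundary. -/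
theorem disjoint_oppSide {x y : Plane} {f : Set Plane} (hxy : x ∈ oppSide y f) :
    Disjoint (oppSide x f) (oppSide y f) := by
  unfold oppSide at *
  split_ifs at * with h1 h2 h2
  · exact absurd h1 hxy
  · exact disjoint_compl_left.mono_right interior_subset
  · exact disjoint_compl_right.mono_left interior_subset
  · exact absurd (interior_subset hxy) h1

theorem subset_of_disjoint_frontier {X : Type*} [TopologicalSpace X] {S U : Set X}
    (hS : IsPreconnected S) (hU : IsOpen U) (h : Disjoint S (frontier U)) (hne : (S ∩ U).Nonempty) :
    S ⊆ U := by
  refine hS.subset_left_of_subset_union hU isClosed_closure.isOpen_compl (v := (closure U)ᶜ)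
    (disjoint_compl_right.mono_left subset_closure) (fun x hx => ?_) hne
  by_contra hn
  simp only [Set.mem_union, Set.mem_compl_iff, not_or, not_not] at hn
  exact Set.disjoint_left.1 h hx ⟨hn.2, by rw [hU.interior_eq]; exact hn.1⟩

/-- Move weight from `a, b, c` onto `d`, in the proportions of the barycentric coordinates of `d`,
until the weight of one of `a, b, c` is used up. -/
theorem convexHull_triple_subset_of_mem {a b c d : Plane}
    (hd : d ∈ convexHull ℝ ({a, b, c} : Set Plane)) :
    convexHull ℝ ({a, b, c} : Set Plane) ⊆ convexHull ℝ {b, c, d} ∪ convexHull ℝ {a, c, d} ∪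
      convexHull ℝ {a, b, d} := by
  intro q hq
  obtain ⟨l, m, n, hl, hm, hn, hs, hd⟩ := mem_convexHull_triple.1 hd
  obtain ⟨α, β, γ, hα, hβ, hγ, hs', hq⟩ := mem_convexHull_triple.1 hq
  have main : ∃ t : ℝ, 0 ≤ t ∧ 0 ≤ α - t * l ∧ 0 ≤ β - t * m ∧ 0 ≤ γ - t * n ∧
      (α - t * l = 0 ∨ β - t * m = 0 ∨ γ - t * n = 0) := by
    -- The first coordinate to vanish is the one with the least ratio of the weight in `q` to the
    -- weight in `d`; this ratio is `t`.
    obtain ⟨i, hi, hmin⟩ := Finset.exists_min_image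
      (Finset.univ.filter fun i : Fin 3 => 0 < ![l, m, n] i)
      (fun i => ![α, β, γ] i / ![l, m, n] i) (by
        by_contra hne
        rw [Finset.not_nonempty_iff_eq_empty, Finset.filter_eq_empty_iff] at hne
        have h0 := @hne 0 (Finset.mem_univ _)
        have h1 := @hne 1 (Finset.mem_univ _)
        have h2 := @hne 2 (Finset.mem_univ _)
        simp at h0 h1 h2
        linarith)
    have hi := (Finset.mem_filter.1 hi).2
    have hnn : ∀ j, 0 ≤ ![α, β, γ] j := by intro j; fin_cases j <;> simpa
    have hnl : ∀ j, 0 ≤ ![l, m, n] j := by intro j; fin_cases j <;> simpa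
    have key : ∀ j, 0 ≤ ![α, β, γ] j - ![α, β, γ] i / ![l, m, n] i * ![l, m, n] j := by
      intro j
      rcases eq_or_lt_of_le (hnl j) with h0 | h0
      · rw [← h0]; simpa using hnn j
      · have := hmin j (by simpa using h0)
        rw [sub_nonneg]
        exact (le_div_iff₀ h0).1 this
    refine ⟨![α, β, γ] i / ![l, m, n] i, div_nonneg (hnn i) hi.le, key 0, key 1, key 2, ?_⟩
    have : ![α, β, γ] i - ![α, β, γ] i / ![l, m, n] i * ![l, m, n] i = 0 := by
      field_simp; simp
    fin_cases i
    · exact .inl this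
    · exact .inr (.inl this)
    · exact .inr (.inr this)
  obtain ⟨t, ht, h1, h2, h3, h⟩ := main
  have hq2 : q = (α - t * l) • a + (β - t * m) • b + (γ - t * n) • c + t • d := by
    rw [hq, hd]; module
  have hsum : (α - t * l) + (β - t * m) + (γ - t * n) + t = 1 := by
    have : t * l + t * m + t * n = t := by rw [← mul_add, ← mul_add, hs, mul_one]
    linarith
  rcases h with h | h | h <;> rw [h] at hq2 hsum
  · exact .inl (.inl (mem_convexHull_triple.2 ⟨_, _, _, h2, h3, ht, by linarith, by simpa using hq2⟩))
  · exact .inl (.inr (mem_convexHull_triple.2 ⟨_, _, _, h1, h3, ht, by linarith, by simpa using hq2⟩))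
  · exact .inr (mem_convexHull_triple.2 ⟨_, _, _, h1, h2, ht, by linarith, by simpa using hq2⟩)

/-- The union of the edges of the straight-line drawing of the complete graph on `K`. -/
def cliqueEdges (K : Set Plane) : Set Plane :=
  {q | ∃ u ∈ K, ∃ v ∈ K, u ≠ v ∧ q ∈ segment ℝ u v}

theorem cliqueEdges_mono {K L : Set Plane} (h : K ⊆ L) : cliqueEdges K ⊆ cliqueEdges L :=
  fun _ ⟨u, hu, v, hv, h'⟩ => ⟨u, h hu, v, h hv, h'⟩

namespace IsPlaneClique

variable {K : Finset Plane}

theorem frontier_subset (h : IsPlaneClique K) {f : Finset Plane} (hf : f ⊆ K) (hc : f.card = 3) :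
    frontier (convexHull ℝ (f : Set Plane)) ⊆ cliqueEdges f := by
  obtain ⟨a, b, c, hab, hac, hbc, rfl⟩ := Finset.card_eq_three.1 hc
  simp only [Finset.insert_subset_iff, Finset.singleton_subset_iff] at hf
  obtain ⟨ha, hb, hc⟩ := hf
  simp only [Finset.coe_insert, Finset.coe_singleton]
  refine (frontier_convexHull_triple_subset fun hcol => ?_).trans ?_
  · rcases hcol.wbtw_or_wbtw_or_wbtw with h' | h' | h' <;> rw [← mem_segment_iff_wbtw] at h'
    · rcases h.eq_or_eq a ha c hc b hb h' with h | h <;> simp_all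
    · rcases h.eq_or_eq b hb a ha c hc h' with h | h <;> simp_all
    · rcases h.eq_or_eq c hc b hb a ha h' with h | h <;> simp_all
  · rintro q ((hq | hq) | hq)
    · exact ⟨a, by simp, b, by simp, hab, hq⟩
    · exact ⟨b, by simp, c, by simp, hbc, hq⟩
    · exact ⟨a, by simp, c, by simp, hac, hq⟩

theorem notMem_cliqueEdges (h : IsPlaneClique K) {f : Finset Plane} (hf : f ⊆ K) {x : Plane}
    (hx : x ∈ K) (hxf : x ∉ f) : x ∉ cliqueEdges f := by
  rintro ⟨u, hu, v, hv, -, hq⟩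
  rcases h.eq_or_eq u (hf hu) v (hf hv) x hx hq with rfl | rfl
  · exact hxf hu
  · exact hxf hv

/-- Four points of the plane have a Radon partition. A partition into two pairs would be a crossing
of two disjoint edges, so one part is a single point. -/
theorem exists_mem_convexHull_erase (h : IsPlaneClique K) (hc : K.card = 4) :
    ∃ x ∈ K, x ∈ convexHull ℝ (K.erase x : Set Plane) := by
  have hna : ¬ AffineIndependent ℝ (fun x : K => (x : Plane)) := by
    intro hi
    have := hi.card_le_finrank_succ
    have h2 := Submodule.finrank_le (vectorSpan ℝ (Set.range fun x : K => (x : Plane)))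
    rw [finrank_euclideanSpace_fin] at h2
    rw [Fintype.card_coe] at this
    omega
  obtain ⟨I, q, hq1, hq2⟩ := Convex.radon_partition hna
  classical
  have main : ∀ A B : Finset Plane, A ∪ B = K → Disjoint A B → A.card ≤ B.card →
      q ∈ convexHull ℝ (A : Set Plane) → q ∈ convexHull ℝ (B : Set Plane) →
      ∃ x ∈ K, x ∈ convexHull ℝ (K.erase x : Set Plane) := by
    rintro A B rfl hd hle hA hB
    rw [Finset.card_union_of_disjoint hd] at hc
    have : A.card = 0 ∨ A.card = 1 ∨ A.card = 2 := by omega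
    rcases this with h0 | h1 | h2
    · rw [Finset.card_eq_zero] at h0
      simp [h0] at hA
    · obtain ⟨x, rfl⟩ := Finset.card_eq_one.1 h1
      have hqx : q = x := by simpa using hA
      subst hqx
      refine ⟨q, by simp, ?_⟩
      have : ({q} ∪ B).erase q = B := by
        rw [Finset.singleton_union, Finset.erase_insert (Finset.disjoint_singleton_left.1 hd)]
      rwa [this]
    · obtain ⟨u, v, huv, rfl⟩ := Finset.card_eq_two.1 h2
      obtain ⟨w, x, hwx, rfl⟩ := Finset.card_eq_two.1 (by omega : B.card = 2)
      simp only [Finset.coe_insert, Finset.coe_singleton, convexHull_pair] at hA hB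
      simp at hd
      exact absurd hB (Set.disjoint_left.1 (h.disjoint u (by simp) v (by simp) w (by simp) x
        (by simp) huv hwx (by grind) (by grind) (by grind) (by grind)) hA)
  have e1 : ((K.filter (∃ h, ⟨·, h⟩ ∈ I) : Finset Plane) : Set Plane) = (fun x : K => (x : Plane)) '' I := by
    ext y; simp
  have e2 : ((K.filter (¬ ∃ h, ⟨·, h⟩ ∈ I) : Finset Plane) : Set Plane) = (fun x : K => (x : Plane)) '' Iᶜ := by
    ext y; simp
    grind
  rw [← e1] at hq1
  rw [← e2] at hq2
  rcases le_total (K.filter (∃ h, ⟨·, h⟩ ∈ I)).card (K.filter (¬ ∃ h, ⟨·, h⟩ ∈ I)).card with hle | hle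
  · exact main _ _ (Finset.filter_union_filter_not_eq _ _) (Finset.disjoint_filter_filter_not _ _ _) hle hq1 hq2
  · exact main _ _ ((Finset.union_comm _ _).trans (Finset.filter_union_filter_not_eq _ _))
      (Finset.disjoint_filter_filter_not _ _ _).symm hle hq2 hq1

theorem notMem_frontier (h : IsPlaneClique K) (hc : K.card = 4) {x : Plane} (hx : x ∈ K) :
    x ∉ frontier (convexHull ℝ (K.erase x : Set Plane)) := fun hf =>
  h.notMem_cliqueEdges (K.erase_subset x) hx (K.notMem_erase x)
    (h.frontier_subset (K.erase_subset x) (by rw [Finset.card_erase_of_mem hx, hc]) hf)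

/-- Otherwise, eliminating `d` from the two convex combinations puts the vertex `x` on the edge
`yz`. The elimination fails only if `n * α = 1`, and then `d = x`. -/
theorem notMem_convexHull_triple (h : IsPlaneClique K) {x y z d : Plane} (hx : x ∈ K) (hy : y ∈ K)
    (hz : z ∈ K) (hxy : x ≠ y) (hxz : x ≠ z) (hdx : d ≠ x)
    (h1 : d ∈ convexHull ℝ ({x, y, z} : Set Plane)) :
    x ∉ convexHull ℝ ({y, z, d} : Set Plane) := by
  intro h2
  obtain ⟨α, β, γ, hα, hβ, hγ, hs, hd⟩ := mem_convexHull_triple.1 h1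
  obtain ⟨l, m, n, hl, hm, hn, hs', hx'⟩ := mem_convexHull_triple.1 h2
  have hn1 : n ≤ 1 := by linarith
  have hα1 : α ≤ 1 := by linarith
  have e : (1 - n * α) • x = (l + n * β) • y + (m + n * γ) • z := by
    have : x = l • y + m • z + n • (α • x + β • y + γ • z) := by rw [← hd]; exact hx'
    rw [sub_smul, one_smul, sub_eq_iff_eq_add]
    exact this.trans (by module)
  rcases eq_or_lt_of_le (mul_le_one₀ hn1 hα hα1) with h0 | h0
  · have : n = 1 := by nlinarith
    subst this
    have e1 : l = 0 := by linarith
    have e2 : m = 0 := by linarith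
    rw [e1, e2] at hx'
    exact hdx (by simpa using hx'.symm)
  · have hpos : 0 < 1 - n * α := by linarith
    have : x ∈ segment ℝ y z := by
      refine ⟨(l + n * β) / (1 - n * α), (m + n * γ) / (1 - n * α), by positivity, by positivity,
        ?_, ?_⟩
      · field_simp
        linear_combination hs' + n * hs
      · rw [div_eq_inv_mul, div_eq_inv_mul, mul_smul, mul_smul, ← smul_add, ← e, smul_smul,
          inv_mul_cancel₀ hpos.ne', one_smul]
    rcases h.eq_or_eq y hy z hz x hx this with h | h
    · exact hxy h
    · exact hxz h

/-- Every point off the edges of a plane drawing of `K₄` is separated by a triangle from the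
fourth vertex. -/
theorem exists_mem_oppSide (h : IsPlaneClique K) (hc : K.card = 4) {q : Plane}
    (hq : q ∉ cliqueEdges K) : ∃ x ∈ K, q ∈ oppSide x (K.erase x) := by
  obtain ⟨d, hd, hdh⟩ := h.exists_mem_convexHull_erase hc
  by_contra! hcon
  have h1 : q ∈ convexHull ℝ (K.erase d : Set Plane) := by
    have := hcon d hd
    rw [oppSide, if_pos hdh] at this
    exact not_not.1 this
  obtain ⟨a, b, c, hab, hac, hbc, habc⟩ := Finset.card_eq_three.1
    (by rw [Finset.card_erase_of_mem hd, hc] : (K.erase d).card = 3)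
  have hK : K = {a, b, c, d} := by
    rw [← Finset.insert_erase hd, habc]; ext; simp; tauto
  have hda : d ≠ a := by rintro rfl; have := K.notMem_erase d; simp [habc] at this
  have hdb : d ≠ b := by rintro rfl; have := K.notMem_erase d; simp [habc] at this
  have hdc : d ≠ c := by rintro rfl; have := K.notMem_erase d; simp [habc] at this
  rw [habc] at h1 hdh
  simp only [Finset.coe_insert, Finset.coe_singleton] at h1 hdh
  -- If `x` is outside the triangle of the other three, its opposite side is the interior. A point
  -- of the closed triangle off the edges is interior, so `q` is outside the closed triangle.
  have key : ∀ x ∈ K, x ∉ convexHull ℝ (K.erase x : Set Plane) →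
      q ∉ convexHull ℝ (K.erase x : Set Plane) := by
    intro x hx hxh hqh
    have := hcon x hx
    rw [oppSide, if_neg hxh] at this
    exact hq (cliqueEdges_mono (by simp) (h.frontier_subset (K.erase_subset x)
      (by rw [Finset.card_erase_of_mem hx, hc]) ⟨subset_closure hqh, this⟩))
  have ha : a ∈ K := by simp [hK]
  have hb : b ∈ K := by simp [hK]
  have hcK : c ∈ K := by simp [hK]
  have ea : ((K.erase a : Finset Plane) : Set Plane) = {b, c, d} := by
    ext; simp [hK]; grind
  have eb : ((K.erase b : Finset Plane) : Set Plane) = {a, c, d} := by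
    ext; simp [hK]; grind
  have ec : ((K.erase c : Finset Plane) : Set Plane) = {a, b, d} := by
    ext; simp [hK]; grind
  have ka := key a ha
  have kb := key b hb
  have kc := key c hcK
  rw [ea] at ka
  rw [eb] at kb
  rw [ec] at kc
  have hdh' := hdh
  rw [Set.insert_comm] at hdh'
  have hdh'' := hdh
  rw [Set.pair_comm, Set.insert_comm] at hdh''
  -- The point `q` lies in the triangle `abc`, which the inner vertex `d` cuts into three; `key`
  -- excludes each of them.
  rcases convexHull_triple_subset_of_mem hdh h1 with (h2 | h2) | h2
  · exact ka (h.notMem_convexHull_triple ha hb hcK hab hac hda hdh) h2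
  · exact kb (h.notMem_convexHull_triple hb ha hcK hab.symm hbc hdb hdh') h2
  · exact kc (h.notMem_convexHull_triple hcK ha hb hac.symm hbc.symm hdc hdh'') h2

/-- A connected set off the edges of a plane drawing of `K₄` is separated by a triangle from the
fourth vertex. -/
theorem exists_subset_oppSide (h : IsPlaneClique K) (hc : K.card = 4) {S : Set Plane}
    (hS : IsPreconnected S) (hne : S.Nonempty) (hd : Disjoint S (cliqueEdges K)) :
    ∃ x ∈ K, S ⊆ oppSide x (K.erase x) ∧ x ∉ closure S := by
  obtain ⟨q, hq⟩ := hne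
  obtain ⟨x, hx, hqx⟩ := h.exists_mem_oppSide hc (Set.disjoint_left.1 hd hq)
  have hsub : S ⊆ oppSide x (K.erase x) := by
    refine subset_of_disjoint_frontier hS (isOpen_oppSide x (Finset.finite_toSet _))
      (hd.mono_right ?_) ⟨q, hq, hqx⟩
    exact (frontier_oppSide_subset _ _).trans ((h.frontier_subset (K.erase_subset x)
      (by rw [Finset.card_erase_of_mem hx, hc])).trans (cliqueEdges_mono (by simp)))
  exact ⟨x, hx, hsub, fun h' => notMem_closure_oppSide (Finset.finite_toSet _)
    (h.notMem_frontier hc hx) (closure_mono hsub h')⟩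

end IsPlaneClique

/-! ### Combinatorics of stacked triangulations -/

/-- The faces of the stacked triangulation obtained from `K₄` on `{0, 1, 2, 3}` by inserting the
vertices `4, 5, …` into the faces in the list (the last one first). -/
def stackFaces : List (Finset ℕ) → Finset (Finset ℕ)
  | [] => (Finset.range 4).powersetCard 3
  | f :: l => (stackFaces l).erase f ∪ f.image fun x => insert (l.length + 4) (f.erase x)

/-- Adjacency in a stacked triangulation. -/
def StackAdj : List (Finset ℕ) → ℕ → ℕ → Prop
  | [], u, v => u < 4 ∧ v < 4 ∧ u ≠ v
  | f :: l, u, v => StackAdj l u v ∨ (u = l.length + 4 ∧ v ∈ f) ∨ (v = l.length + 4 ∧ u ∈ f)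

/-- Each face in the list is a face of the stacked triangulation given by the remaining list, other
than the outer face `{0, 1, 2}`. -/
def IsStack : List (Finset ℕ) → Prop
  | [] => True
  | f :: l => f ∈ (stackFaces l).erase {0, 1, 2} ∧ IsStack l

theorem outer_mem_stackFaces : ∀ {l : List (Finset ℕ)}, IsStack l → {0, 1, 2} ∈ stackFaces l
  | [], _ => by decide
  | f :: l, h => by
    have h' := Finset.mem_erase.1 h.1
    exact Finset.mem_union_left _ (Finset.mem_erase.2 ⟨h'.1.symm, outer_mem_stackFaces h.2⟩)

theorem stackFaces_props : ∀ {l : List (Finset ℕ)}, IsStack l → ∀ f ∈ stackFaces l,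
    f.card = 3 ∧ ∀ v ∈ f, v < l.length + 4
  | [], _, f, hf => by
    rw [stackFaces, Finset.mem_powersetCard] at hf
    exact ⟨hf.2, fun v hv => by simpa using hf.1 hv⟩
  | g :: l, h, f, hf => by
    rw [stackFaces, Finset.mem_union, Finset.mem_image] at hf
    rcases hf with hf | ⟨x, hx, rfl⟩
    · have := stackFaces_props h.2 f (Finset.mem_of_mem_erase hf)
      exact ⟨this.1, fun v hv => (this.2 v hv).trans (by simp)⟩
    · have := stackFaces_props h.2 g (Finset.mem_of_mem_erase h.1)
      refine ⟨?_, fun v hv => ?_⟩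
      · rw [Finset.card_insert_of_notMem fun hm =>
          absurd (this.2 _ (Finset.mem_of_mem_erase hm)) (lt_irrefl _),
          Finset.card_erase_of_mem hx, this.1]
      · rcases Finset.mem_insert.1 hv with rfl | hv
        · simp
        · exact (this.2 v (Finset.mem_of_mem_erase hv)).trans (by simp)

theorem card_stackFaces : ∀ {l : List (Finset ℕ)}, IsStack l →
    (stackFaces l).card = 2 * l.length + 4
  | [], _ => by decide
  | f :: l, h => by
    have hf := Finset.mem_of_mem_erase h.1
    have hp := stackFaces_props h.2 f hf
    have hN : l.length + 4 ∉ f := fun hm => absurd (hp.2 _ hm) (lt_irrefl _)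
    rw [stackFaces, Finset.card_union_of_disjoint, Finset.card_erase_of_mem hf,
      card_stackFaces h.2, Finset.card_image_of_injOn, hp.1]
    · simp; omega
    · intro x hx y hy hxy
      simp only at hxy
      by_contra hne
      have : x ∈ insert (l.length + 4) (f.erase y) :=
        Finset.mem_insert_of_mem (Finset.mem_erase.2 ⟨hne, hx⟩)
      rw [← hxy, Finset.mem_insert] at this
      rcases this with rfl | h
      · exact hN hx
      · simp at h
    · rw [Finset.disjoint_left]
      intro g hg hg'
      obtain ⟨x, -, rfl⟩ := Finset.mem_image.1 hg'
      exact absurd ((stackFaces_props h.2 _ (Finset.mem_of_mem_erase hg)).2 _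
        (Finset.mem_insert_self _ _)) (lt_irrefl _)

theorem StackAdj.symm : ∀ {l : List (Finset ℕ)} {u v : ℕ}, StackAdj l u v → StackAdj l v u
  | [], _, _, h => ⟨h.2.1, h.1, h.2.2.symm⟩
  | _ :: _, _, _, h => h.imp StackAdj.symm Or.symm

theorem StackAdj.lt_and_ne : ∀ {l : List (Finset ℕ)} {u v : ℕ}, IsStack l → StackAdj l u v →
    u < l.length + 4 ∧ v < l.length + 4 ∧ u ≠ v
  | [], _, _, _, h => h
  | f :: l, u, v, hl, h => by
    have hp := (stackFaces_props hl.2 f (Finset.mem_of_mem_erase hl.1)).2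
    simp only [List.length_cons]
    rcases h with h | ⟨rfl, h⟩ | ⟨rfl, h⟩
    · have := h.lt_and_ne hl.2
      omega
    · have := hp _ h
      omega
    · have := hp _ h
      omega

theorem stackAdj_of_mem_face : ∀ {l : List (Finset ℕ)}, ∀ f ∈ stackFaces l, IsStack l →
    ∀ u ∈ f, ∀ v ∈ f, u ≠ v → StackAdj l u v
  | [], f, hf, _, u, hu, v, hv, h => by
    rw [stackFaces, Finset.mem_powersetCard] at hf
    exact ⟨by simpa using hf.1 hu, by simpa using hf.1 hv, h⟩
  | g :: l, f, hf, hl, u, hu, v, hv, h => by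
    rw [stackFaces, Finset.mem_union, Finset.mem_image] at hf
    rcases hf with hf | ⟨x, hx, rfl⟩
    · exact .inl (stackAdj_of_mem_face f (Finset.mem_of_mem_erase hf) hl.2 u hu v hv h)
    · rw [Finset.mem_insert, Finset.mem_erase] at hu hv
      rcases hu with rfl | hu <;> rcases hv with rfl | hv
      · exact absurd rfl h
      · exact .inr (.inl ⟨rfl, hv.2⟩)
      · exact .inr (.inr ⟨rfl, hu.2⟩)
      · exact .inl (stackAdj_of_mem_face g (Finset.mem_of_mem_erase hl.1) hl.2 u hu.2 v hv.2 h)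

/-- Every face of a stacked triangulation lies in a `K₄`. -/
theorem exists_stackAdj_face : ∀ {l : List (Finset ℕ)}, ∀ f ∈ stackFaces l, IsStack l →
    ∃ z, z ∉ f ∧ ∀ u ∈ f, StackAdj l z u
  | [], f, hf, _ => by
    rw [stackFaces, Finset.mem_powersetCard] at hf
    obtain ⟨z, hz, hzf⟩ := Finset.exists_mem_notMem_of_card_lt_card
      (show f.card < (Finset.range 4).card by simp [hf.2])
    exact ⟨z, hzf, fun u hu => ⟨by simpa using hz, by simpa using hf.1 hu, by grind⟩⟩
  | g :: l, f, hf, hl => by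
    rw [stackFaces, Finset.mem_union, Finset.mem_image] at hf
    rcases hf with hf | ⟨x, hx, rfl⟩
    · obtain ⟨z, hz, h⟩ := exists_stackAdj_face f (Finset.mem_of_mem_erase hf) hl.2
      exact ⟨z, hz, fun u hu => .inl (h u hu)⟩
    · have hg := Finset.mem_of_mem_erase hl.1
      have hxN := (stackFaces_props hl.2 g hg).2 x hx
      refine ⟨x, ?_, fun u hu => ?_⟩
      · rw [Finset.mem_insert, Finset.mem_erase]
        rintro (rfl | h)
        · exact absurd hxN (lt_irrefl _)
        · exact h.1 rfl
      · rcases Finset.mem_insert.1 hu with rfl | hu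
        · exact .inr (.inr ⟨rfl, hx⟩)
        · rw [Finset.mem_erase] at hu
          exact .inl (stackAdj_of_mem_face g hg hl.2 x hx u hu.2 hu.1.symm)

/-! ### Straight-line drawings of stacked triangulations and their faces -/

/-- The straight-line drawing with vertex positions `p` of the graph with vertices `0, …, N - 1` and
adjacency relation `A` has no crossings. -/
structure IsStraightDrawing (N : ℕ) (A : ℕ → ℕ → Prop) (p : ℕ → Plane) : Prop where
  inj : ∀ u < N, ∀ v < N, p u = p v → u = v
  eq_or_eq : ∀ u v w, A u v → w < N → p w ∈ segment ℝ (p u) (p v) → w = u ∨ w = v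
  noncrossing : ∀ u v w x q, A u v → A w x → s(u, v) ≠ s(w, x) →
    q ∈ segment ℝ (p u) (p v) → q ∈ segment ℝ (p w) (p x) → ∃ y < N, q = p y

/-- The straight-line drawing of a stacked triangulation with vertex positions `p` has no
crossings. -/
abbrev IsStackDrawing (l : List (Finset ℕ)) (p : ℕ → Plane) : Prop :=
  IsStraightDrawing (l.length + 4) (StackAdj l) p

namespace IsStackDrawing

variable {l : List (Finset ℕ)} {p : ℕ → Plane}

theorem tail {f : Finset ℕ} (hl : IsStack (f :: l)) (h : IsStackDrawing (f :: l) p) :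
    IsStackDrawing l p where
  inj u hu v hv := h.inj u (by simp; omega) v (by simp; omega)
  eq_or_eq u v w huv hw := h.eq_or_eq u v w (.inl huv) (by simp; omega)
  noncrossing u v w x q huv hwx hne h1 h2 := by
    obtain ⟨y, hy, rfl⟩ := h.noncrossing u v w x q (.inl huv) (.inl hwx) hne h1 h2
    -- The common point could a priori be the removed vertex; but a vertex on an old edge is one of
    -- its ends, hence old.
    refine ⟨y, ?_, rfl⟩
    have := huv.lt_and_ne hl.2
    rcases h.eq_or_eq u v y (.inl huv) hy h1 with rfl | rfl
    · exact this.1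
    · exact this.2.1

theorem isPlaneClique (h : IsStackDrawing l p) {K : Finset ℕ}
    (hK : ∀ u ∈ K, ∀ v ∈ K, u ≠ v → StackAdj l u v) (hlt : ∀ u ∈ K, u < l.length + 4) :
    IsPlaneClique (K.image p) where
  eq_or_eq := by
    simp only [Finset.forall_mem_image]
    intro u hu v hv w hw hm
    by_cases huv : u = v
    · subst huv
      left
      simpa using hm
    · rcases h.eq_or_eq u v w (hK u hu v hv huv) (hlt w hw) hm with rfl | rfl <;> simp
  disjoint := by
    simp only [Finset.forall_mem_image]
    intro u hu v hv w hw x hx huv hwx huw hux hvw hvx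
    rw [Set.disjoint_left]
    intro q h1 h2
    have huv' := hK u hu v hv (by grind)
    have hwx' := hK w hw x hx (by grind)
    obtain ⟨y, hy, rfl⟩ := h.noncrossing u v w x q huv' hwx' (by
      intro h; rcases Sym2.eq_iff.1 h with ⟨rfl, rfl⟩ | ⟨rfl, rfl⟩ <;> simp_all) h1 h2
    rcases h.eq_or_eq u v y huv' hy h1 with rfl | rfl <;>
    rcases h.eq_or_eq w x _ hwx' hy h2 with rfl | rfl <;> simp_all

theorem exists_subset_oppSide (h : IsStackDrawing l p) {K : Finset ℕ}
    (hK : ∀ u ∈ K, ∀ v ∈ K, u ≠ v → StackAdj l u v) (hlt : ∀ u ∈ K, u < l.length + 4)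
    (hc : K.card = 4) {S : Set Plane} (hS : IsPreconnected S) (hne : S.Nonempty)
    (hd : ∀ u v, StackAdj l u v → Disjoint S (segment ℝ (p u) (p v))) :
    ∃ x ∈ K, S ⊆ oppSide (p x) (p '' (K.erase x : Finset ℕ)) ∧ p x ∉ closure S := by
  have hinj : Set.InjOn p K := fun u hu v hv => h.inj u (hlt u hu) v (hlt v hv)
  obtain ⟨y, hy, h1, h2⟩ := (h.isPlaneClique hK hlt).exists_subset_oppSide
    (by rw [Finset.card_image_of_injOn hinj, hc]) hS hne (by
      rw [Set.disjoint_left]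
      rintro q hq ⟨_, hu', _, hv', huv, hm⟩
      obtain ⟨u, hu, rfl⟩ := Finset.mem_image.1 (Finset.mem_coe.1 hu')
      obtain ⟨v, hv, rfl⟩ := Finset.mem_image.1 (Finset.mem_coe.1 hv')
      exact Set.disjoint_left.1 (hd u v (hK u hu v hv (by grind))) hq hm)
  obtain ⟨x, hx, rfl⟩ := Finset.mem_image.1 hy
  refine ⟨x, hx, ?_, h2⟩
  have : (((K.image p).erase (p x) : Finset Plane) : Set Plane) = p '' (K.erase x : Finset ℕ) := by
    ext q
    simp only [Finset.coe_erase, Finset.coe_image, Set.mem_sdiff, Set.mem_image, Finset.mem_coe,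
      Set.mem_singleton_iff]
    constructor
    · rintro ⟨⟨u, hu, rfl⟩, hne⟩
      exact ⟨u, ⟨hu, by grind⟩, rfl⟩
    · rintro ⟨u, ⟨hu, hne⟩, rfl⟩
      exact ⟨⟨u, hu, rfl⟩, fun he => hne (hinj hu hx he)⟩
  rwa [← this]

/-- The open star of the last vertex. -/
theorem exists_star {f : Finset ℕ} (hl : IsStack (f :: l)) (h : IsStackDrawing (f :: l) p) :
    ∃ W : Set Plane, IsPreconnected W ∧ p (l.length + 4) ∈ W ∧ (∀ u ∈ f, p u ∈ closure W) ∧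
      ∀ u v, StackAdj l u v → Disjoint W (segment ℝ (p u) (p v)) := by
  have hf := Finset.mem_of_mem_erase hl.1
  have hp := stackFaces_props hl.2 f hf
  have hfne : f.Nonempty := Finset.card_pos.1 (by omega)
  have hcl : ∀ x y : Plane, segment ℝ x y ⊆ closure (openSegment ℝ x y) := fun x y =>
    segment_subset_closure_openSegment
  refine ⟨⋃ u ∈ (f : Set ℕ), insert (p (l.length + 4)) (openSegment ℝ (p (l.length + 4)) (p u)), ?_, ?_, ?_, ?_⟩
  · rw [← Set.sUnion_image ]
    refine isPreconnected_sUnion (p (l.length + 4)) _ ?_ ?_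
    · rintro _ ⟨u, -, rfl⟩
      exact Set.mem_insert _ _
    · rintro _ ⟨u, -, rfl⟩
      refine (convex_openSegment _ _).isPreconnected.subset_closure (Set.subset_insert _ _) ?_
      exact Set.insert_subset (hcl _ _ (left_mem_segment _ _ _)) subset_closure
  · obtain ⟨u, hu⟩ := hfne
    exact Set.mem_biUnion hu (Set.mem_insert _ _)
  · intro u hu
    refine closure_mono ?_ (hcl _ _ (right_mem_segment ℝ (p (l.length + 4)) (p u)))
    exact (Set.subset_insert _ _).trans (Set.subset_biUnion_of_mem (s := (f : Set ℕ)) (u := fun u => insert (p (l.length + 4)) (openSegment ℝ (p (l.length + 4)) (p u))) hu)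
  · intro u v huv
    have huv' := huv.lt_and_ne hl.2
    have hN : p (l.length + 4) ∉ segment ℝ (p u) (p v) := fun hm => by
      rcases h.eq_or_eq u v _ (.inl huv) (by simp) hm with h | h <;> omega
    rw [Set.disjoint_left]
    intro q hq hm
    simp only [Set.mem_iUnion, exists_prop] at hq
    obtain ⟨a, ha, rfl | hq⟩ := hq
    · exact hN hm
    · have hNa : StackAdj (f :: l) (l.length + 4) a := .inr (.inl ⟨rfl, ha⟩)
      obtain ⟨y, hy, rfl⟩ := h.noncrossing u v _ a q (.inl huv) hNa (by
        intro he; rcases Sym2.eq_iff.1 he with h | h <;> omega) hm (openSegment_subset_segment _ _ _ hq)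
      rcases h.eq_or_eq _ a y hNa hy (openSegment_subset_segment _ _ _ hq) with rfl | rfl
      · exact hN hm
      · have := (hNa.lt_and_ne hl)
        rw [right_mem_openSegment_iff] at hq
        exact this.2.2 (h.inj _ this.1 _ this.2.1 hq)

/-- The vertices in the closure of a connected set off the edges of a drawing of a stacked
triangulation belong to a common face. -/
theorem exists_face : ∀ {l : List (Finset ℕ)} {p : ℕ → Plane}, IsStack l → IsStackDrawing l p →
    ∀ {S : Set Plane}, IsPreconnected S → S.Nonempty →
    (∀ u v, StackAdj l u v → Disjoint S (segment ℝ (p u) (p v))) →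
    ∃ f ∈ stackFaces l, ∀ v < l.length + 4, p v ∈ closure S → v ∈ f
  | [], p, hl, h, S, hS, hne, hd => by
    obtain ⟨x, hx, -, hxS⟩ := h.exists_subset_oppSide (K := Finset.range 4)
      (fun u hu v hv huv => ⟨by simpa using hu, by simpa using hv, huv⟩) (fun u hu => by simpa using hu)
      (by simp) hS hne hd
    refine ⟨(Finset.range 4).erase x, ?_, fun v hv hvS => ?_⟩
    · rw [stackFaces, Finset.mem_powersetCard]
      exact ⟨Finset.erase_subset _ _, by rw [Finset.card_erase_of_mem hx]; simp⟩
    · exact Finset.mem_erase.2 ⟨fun e => hxS (e ▸ hvS), by simpa using hv⟩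
  | f :: l, p, hl, h, S, hS, hne, hd => by
    have ht := h.tail hl
    have hf := Finset.mem_of_mem_erase hl.1
    have hp := stackFaces_props hl.2 f hf
    have hNf : l.length + 4 ∉ f := fun hm => absurd (hp.2 _ hm) (lt_irrefl _)
    have hd' : ∀ u v, StackAdj l u v → Disjoint S (segment ℝ (p u) (p v)) :=
      fun u v huv => hd u v (.inl huv)
    obtain ⟨W, hW, hNW, hWf, hWd⟩ := h.exists_star hl
    have hlt : ∀ v, v < (f :: l).length + 4 → v = l.length + 4 ∨ v < l.length + 4 := by
      intro v hv; simp at hv; omega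
    have hface : ∀ x ∈ f, insert (l.length + 4) (f.erase x) ∈ stackFaces (f :: l) := fun x hx =>
      Finset.mem_union_right _ (Finset.mem_image_of_mem _ hx)
    -- By induction the vertices in the closure of `T` lie in one old face; it contains `f` and has
    -- as many vertices, so it is `f`.
    have huniq : ∀ {T : Set Plane}, IsPreconnected T → T.Nonempty →
        (∀ u v, StackAdj l u v → Disjoint T (segment ℝ (p u) (p v))) →
        (∀ u ∈ f, p u ∈ closure T) → ∀ v < l.length + 4, p v ∈ closure T → v ∈ f := by
      intro T hT hTne hTd hTf v hv hvT
      obtain ⟨g, hg, hgT⟩ := exists_face hl.2 ht hT hTne hTd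
      have : f = g := Finset.eq_of_subset_of_card_le (fun u hu => hgT u (hp.2 u hu) (hTf u hu))
        (by rw [hp.1, (stackFaces_props hl.2 g hg).1])
      exact this ▸ hgT v hv hvT
    -- If all old vertices in the closure of `S` belong to `f`, it remains to find a vertex of `f`
    -- that the closure misses.
    have hclique : (∀ v < l.length + 4, p v ∈ closure S → v ∈ f) →
        ∃ f' ∈ stackFaces (f :: l), ∀ v < (f :: l).length + 4, p v ∈ closure S → v ∈ f' := by
      intro hSf
      have hmiss : ∀ x ∈ f, p x ∉ closure S →
        ∃ f' ∈ stackFaces (f :: l), ∀ v < (f :: l).length + 4, p v ∈ closure S → v ∈ f' := by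
        refine fun x hx hxS => ⟨_, hface x hx, fun v hv hvS => ?_⟩
        rcases hlt v hv with rfl | hv
        · exact Finset.mem_insert_self _ _
        · exact Finset.mem_insert_of_mem
            (Finset.mem_erase.2 ⟨fun e => hxS (e ▸ hvS), hSf v hv hvS⟩)
      obtain ⟨x, hx, hxS, hxcl⟩ := h.exists_subset_oppSide (K := insert (l.length + 4) f)
        (fun u hu v hv huv => by
          rcases Finset.mem_insert.1 hu with rfl | hu <;> rcases Finset.mem_insert.1 hv with rfl | hv
          · exact absurd rfl huv
          · exact .inr (.inl ⟨rfl, hv⟩)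
          · exact .inr (.inr ⟨rfl, hu⟩)
          · exact .inl (stackAdj_of_mem_face f hf hl.2 u hu v hv huv))
        (fun u hu => by
          rcases Finset.mem_insert.1 hu with rfl | hu
          · simp
          · exact (hp.2 u hu).trans (by simp))
        (by rw [Finset.card_insert_of_notMem hNf, hp.1]) hS hne hd
      rcases Finset.mem_insert.1 hx with rfl | hx
      swap; · exact hmiss x hx hxcl
      -- In the remaining case `S` is on the side of `f` away from the new vertex. A second `K₄` on
      -- `f`, with old apex `z`, rules this out unless a vertex of `f` is missed: both `S` and the
      -- star `W` lie on the side away from `z`, so `S` is on both sides of `f`.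
      rw [Finset.erase_insert hNf] at hxS
      obtain ⟨z, hzf, hz⟩ := exists_stackAdj_face f hf hl.2
      have hadj : ∀ u ∈ insert z f, ∀ v ∈ insert z f, u ≠ v → StackAdj l u v :=
        fun u hu v hv huv => by
          rcases Finset.mem_insert.1 hu with hu' | hu' <;>
            rcases Finset.mem_insert.1 hv with hv' | hv'
          · exact absurd (hu'.trans hv'.symm) huv
          · exact hu' ▸ hz v hv'
          · exact hv' ▸ (hz u hu').symm
          · exact stackAdj_of_mem_face f hf hl.2 u hu' v hv' huv
      have hzlt : ∀ u ∈ insert z f, u < l.length + 4 := fun u hu => by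
          rcases Finset.mem_insert.1 hu with rfl | hu
          · obtain ⟨v, hv⟩ : f.Nonempty := Finset.card_pos.1 (by omega)
            exact ((hz v hv).lt_and_ne hl.2).1
          · exact hp.2 u hu
      have hzc : (insert z f).card = 4 := by rw [Finset.card_insert_of_notMem hzf, hp.1]
      obtain ⟨y, hy, hyS, hycl⟩ := ht.exists_subset_oppSide hadj hzlt hzc hS hne hd'
      rcases Finset.mem_insert.1 hy with rfl | hy
      swap; · exact hmiss y hy hycl
      obtain ⟨y', hy', hyW, hyclW⟩ := ht.exists_subset_oppSide hadj hzlt hzc hW ⟨_, hNW⟩ hWd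
      rcases Finset.mem_insert.1 hy' with rfl | hy'
      swap; · exact absurd (hWf y' hy') hyclW
      rw [Finset.erase_insert hzf] at hyS hyW
      obtain ⟨q, hq⟩ := hne
      exact absurd (hyS hq) (Set.disjoint_left.1 (disjoint_oppSide (hyW hNW)) (hxS hq))
    by_cases hcl : p (l.length + 4) ∈ closure S
    · refine hclique fun v hv hvS => ?_
      -- Joining `S` to the star `W` through the new vertex gives a connected set, off the old
      -- edges, whose closure contains all of `f`.
      have hS' : IsPreconnected (insert (p (l.length + 4)) S) :=
        hS.subset_closure (Set.subset_insert _ _) (Set.insert_subset hcl subset_closure)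
      refine huniq (hS'.union _ (Set.mem_insert _ _) hNW hW) ⟨_, .inr hNW⟩ (fun u w huw => ?_)
        (fun u hu => closure_mono Set.subset_union_right (hWf u hu)) v hv
        (closure_mono ((Set.subset_insert _ _).trans Set.subset_union_left) hvS)
      rw [Set.disjoint_union_left, Set.disjoint_insert_left]
      exact ⟨⟨Set.disjoint_left.1 (hWd u w huw) hNW, hd' u w huw⟩, hWd u w huw⟩
    · obtain ⟨g, hg, hgS⟩ := exists_face hl.2 ht hS hne hd'
      by_cases hgf : g = f
      · exact hclique (hgf ▸ hgS)
      · refine ⟨g, Finset.mem_union_left _ (Finset.mem_erase.2 ⟨hgf, hg⟩), fun v hv hvS => ?_⟩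
        rcases hlt v hv with rfl | hv
        · exact absurd hvS hcl
        · exact hgS v hv hvS

/-- A drawing determines the stacked triangulation. -/
theorem eq_of_length_eq : ∀ {l l' : List (Finset ℕ)} {p : ℕ → Plane}, IsStack l → IsStack l' →
    IsStackDrawing l p → IsStackDrawing l' p → l.length = l'.length → l = l'
  | [], [], _, _, _, _, _, _ => rfl
  | [], _ :: _, _, _, _, _, _, h => by simp at h
  | _ :: _, [], _, _, _, _, _, h => by simp at h
  | f :: l, f' :: l', p, hl, hl', h, h', hlen => by
    have hlen' : l.length = l'.length := by simpa using hlen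
    obtain rfl := eq_of_length_eq hl.2 hl'.2 (h.tail hl) (h'.tail hl') hlen'
    congr 1
    obtain ⟨W, hW, hNW, hWf, hWd⟩ := h.exists_star hl
    obtain ⟨W', hW', hNW', hWf', hWd'⟩ := h'.exists_star hl'
    -- The stars of the last vertex in the two drawings share their centre, so their union is
    -- connected and its closure contains both `f` and `f'`.
    obtain ⟨g, hg, hgW⟩ := exists_face hl.2 (h.tail hl) (hW.union _ hNW hNW' hW') ⟨_, .inl hNW⟩
      (fun u v huv => Set.disjoint_union_left.2 ⟨hWd u v huv, hWd' u v huv⟩)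
    have key : ∀ f ∈ stackFaces l, (∀ u ∈ f, p u ∈ closure (W ∪ W')) → f = g := fun f hf hcl => by
      have hp := stackFaces_props hl.2 f hf
      exact Finset.eq_of_subset_of_card_le (fun u hu => hgW u (hp.2 u hu) (hcl u hu))
        (by rw [hp.1, (stackFaces_props hl.2 g hg).1])
    rw [key f (Finset.mem_of_mem_erase hl.1) fun u hu =>
        closure_mono Set.subset_union_left (hWf u hu),
      key f' (Finset.mem_of_mem_erase hl'.1) fun u hu =>
        closure_mono Set.subset_union_right (hWf' u hu)]

end IsStackDrawing

/-! ### Planarity: inserting vertices at centroids -/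

/-- The open triangle (or simplex) spanned by the points `p i`, `i ∈ f`. -/
def openTriangle (p : ℕ → Plane) (f : Finset ℕ) : Set Plane :=
  {q | ∃ ω : ℕ → ℝ, (∀ i ∈ f, 0 < ω i) ∧ ∑ i ∈ f, ω i = 1 ∧ q = ∑ i ∈ f, ω i • p i}

/-- The points `p i`, `i ∈ f`, are affinely independent. -/
def AffIndepOn (p : ℕ → Plane) (f : Finset ℕ) : Prop :=
  ∀ ω : ℕ → ℝ, ∑ i ∈ f, ω i = 0 → ∑ i ∈ f, ω i • p i = 0 → ∀ i ∈ f, ω i = 0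

theorem AffIndepOn.eq {p : ℕ → Plane} {f : Finset ℕ} (h : AffIndepOn p f) {ω ω' : ℕ → ℝ}
    (hs : ∑ i ∈ f, ω i = ∑ i ∈ f, ω' i) (hq : ∑ i ∈ f, ω i • p i = ∑ i ∈ f, ω' i • p i) :
    ∀ i ∈ f, ω i = ω' i := fun i hi =>
  sub_eq_zero.1 (h (fun i => ω i - ω' i) (by rw [Finset.sum_sub_distrib, hs, sub_self])
    (by simp only [sub_smul]; rw [Finset.sum_sub_distrib, hq, sub_self]) i hi)

theorem AffIndepOn.congr {p p' : ℕ → Plane} {f : Finset ℕ} (h : AffIndepOn p f)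
    (hp : ∀ i ∈ f, p' i = p i) : AffIndepOn p' f := fun ω hs h0 =>
  h ω hs ((Finset.sum_congr rfl fun i hi => by rw [hp i hi]).trans h0)

theorem openTriangle_congr {p p' : ℕ → Plane} {f : Finset ℕ} (hp : ∀ i ∈ f, p' i = p i) :
    openTriangle p' f = openTriangle p f := by
  ext q
  have : ∀ ω : ℕ → ℝ, ∑ i ∈ f, ω i • p' i = ∑ i ∈ f, ω i • p i := fun ω =>
    Finset.sum_congr rfl fun i hi => by rw [hp i hi]
  simp only [openTriangle, this]

section Centroid

variable {p p' : ℕ → Plane} {f : Finset ℕ} {N : ℕ}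

/-- Barycentric coordinates in a new triangle are converted to coordinates in `f`, where all later
comparisons take place: the weight of the centroid is shared equally by the three vertices. -/
theorem sum_insert_erase_smul (hN : N ∉ f) (hp : ∀ i ∈ f, p' i = p i)
    (hpN : p' N = ∑ i ∈ f, (1 / 3 : ℝ) • p i) {x : ℕ} (hx : x ∈ f) (ω : ℕ → ℝ) :
    ∑ i ∈ insert N (f.erase x), ω i • p' i =
      ∑ i ∈ f, ((if i = x then 0 else ω i) + ω N / 3) • p i := by
  rw [Finset.sum_insert (fun h => hN (Finset.mem_of_mem_erase h)), hpN, Finset.smul_sum]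
  simp only [add_smul]
  rw [Finset.sum_add_distrib, add_comm]
  congr 1
  · rw [← Finset.add_sum_erase f _ hx]
    simp only [if_true, zero_smul, zero_add]
    refine Finset.sum_congr rfl fun i hi => ?_
    rw [Finset.mem_erase] at hi
    rw [if_neg hi.1, hp i hi.2]
  · refine Finset.sum_congr rfl fun i _ => ?_
    rw [smul_smul, mul_one_div]

theorem sum_insert_erase (hN : N ∉ f) (hf : f.card = 3) {x : ℕ} (hx : x ∈ f) (ω : ℕ → ℝ) :
    ∑ i ∈ insert N (f.erase x), ω i = ∑ i ∈ f, ((if i = x then 0 else ω i) + ω N / 3) := by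
  rw [Finset.sum_insert (fun h => hN (Finset.mem_of_mem_erase h)), Finset.sum_add_distrib, add_comm]
  congr 1
  · rw [← Finset.add_sum_erase f _ hx]
    simp only [if_true, zero_add]
    refine Finset.sum_congr rfl fun i hi => ?_
    rw [Finset.mem_erase] at hi
    rw [if_neg hi.1]
  · rw [Finset.sum_const, hf, nsmul_eq_mul]
    push_cast
    ring

theorem AffIndepOn.insert_erase (h : AffIndepOn p f) (hN : N ∉ f) (hf : f.card = 3)
    (hp : ∀ i ∈ f, p' i = p i) (hpN : p' N = ∑ i ∈ f, (1 / 3 : ℝ) • p i) {x : ℕ} (hx : x ∈ f) :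
    AffIndepOn p' (insert N (f.erase x)) := by
  intro ω h0 h1
  rw [sum_insert_erase hN hf hx] at h0
  rw [sum_insert_erase_smul hN hp hpN hx] at h1
  have key := h _ h0 h1
  have hx0 := key x hx
  simp only [if_true, zero_add] at hx0
  have hN0 : ω N = 0 := by linarith
  intro i hi
  rcases Finset.mem_insert.1 hi with rfl | hi
  · exact hN0
  · rw [Finset.mem_erase] at hi
    have := key i hi.2
    simpa [hi.1, hN0] using this

/-- Points of the new triangle opposite to `x` have their least barycentric coordinate at `x`. -/
theorem exists_weight_of_mem_openTriangle (hN : N ∉ f) (hf : f.card = 3)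
    (hp : ∀ i ∈ f, p' i = p i) (hpN : p' N = ∑ i ∈ f, (1 / 3 : ℝ) • p i) {x : ℕ} (hx : x ∈ f)
    {q : Plane} (hq : q ∈ openTriangle p' (insert N (f.erase x))) :
    ∃ ω : ℕ → ℝ, (∀ i ∈ f, 0 < ω i) ∧ ∑ i ∈ f, ω i = 1 ∧ q = ∑ i ∈ f, ω i • p i ∧
      ∀ i ∈ f, i ≠ x → ω x < ω i := by
  obtain ⟨ω, hpos, hs, hq⟩ := hq
  rw [sum_insert_erase hN hf hx] at hs
  rw [sum_insert_erase_smul hN hp hpN hx] at hq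
  have h0 := hpos N (Finset.mem_insert_self _ _)
  refine ⟨_, fun i hi => ?_, hs, hq, fun i hi hix => ?_⟩
  · by_cases hix : i = x
    · simp [hix, h0]
    · have := hpos i (Finset.mem_insert_of_mem (Finset.mem_erase.2 ⟨hix, hi⟩))
      simp only [hix, if_false]
      positivity
  · have := hpos i (Finset.mem_insert_of_mem (Finset.mem_erase.2 ⟨hix, hi⟩))
    simpa [hix] using this

theorem exists_weight_of_mem_segment (hf : f.card = 3) {a : ℕ} (ha : a ∈ f)
    {q : Plane} (hq : q ∈ segment ℝ (∑ i ∈ f, (1 / 3 : ℝ) • p i) (p a)) :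
    ∃ s t : ℝ, 0 ≤ s ∧ 0 ≤ t ∧ s + t = 1 ∧ ∑ i ∈ f, (s / 3 + if i = a then t else 0) = 1 ∧
      q = ∑ i ∈ f, (s / 3 + if i = a then t else 0) • p i := by
  obtain ⟨s, t, hs, ht, hst, rfl⟩ := hq
  refine ⟨s, t, hs, ht, hst, ?_, ?_⟩
  · rw [Finset.sum_add_distrib, Finset.sum_const, hf, Finset.sum_ite_eq' f a, if_pos ha,
      nsmul_eq_mul, ← hst]
    push_cast
    ring
  · simp only [add_smul, ite_smul, zero_smul]
    rw [Finset.sum_add_distrib, Finset.sum_ite_eq' f a, if_pos ha, Finset.smul_sum]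
    simp only [smul_smul, mul_one_div]

end Centroid

/-- A straight-line drawing in which the open triangles spanned by the elements of `F` are
nondegenerate, disjoint, and not met by any edge. -/
structure IsFaceDrawing (N : ℕ) (A : ℕ → ℕ → Prop) (F : Finset (Finset ℕ)) (p : ℕ → Plane) : Prop
    extends IsStraightDrawing N A p where
  affIndepOn : ∀ f ∈ F, AffIndepOn p f
  disjoint_edge : ∀ f ∈ F, ∀ u v, A u v → Disjoint (openTriangle p f) (segment ℝ (p u) (p v))
  disjoint_face : ∀ f ∈ F, ∀ g ∈ F, f ≠ g → Disjoint (openTriangle p f) (openTriangle p g)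

/-- Everything new stays in the open triangle of `f`, except for the old ends of the new edges, so
it cannot interfere with the rest of the drawing. Inside that triangle, the parts are told apart by
their coordinates. The family `F` will omit the outer face, whose triangle contains the others. -/
theorem IsFaceDrawing.insert {N : ℕ} {A : ℕ → ℕ → Prop} {F : Finset (Finset ℕ)} {p : ℕ → Plane}
    (h : IsFaceDrawing N A F p) (hA : ∀ u v, A u v → u < N ∧ v < N) (hdeg : ∀ u < N, ∃ v, A u v)
    (hF : ∀ f ∈ F, ∀ v ∈ f, v < N) {f : Finset ℕ} (hf : f ∈ F) (hc : f.card = 3) :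
    ∃ p', IsFaceDrawing (N + 1) (fun u v => A u v ∨ (u = N ∧ v ∈ f) ∨ (v = N ∧ u ∈ f))
      (F.erase f ∪ f.image fun x => Insert.insert N (f.erase x)) p' := by
  set w : Plane := ∑ i ∈ f, (1 / 3 : ℝ) • p i with hw
  set p' : ℕ → Plane := Function.update p N w with hp'
  have hold : ∀ u < N, p' u = p u := fun u hu => Function.update_of_ne hu.ne _ _
  have hnew : p' N = w := Function.update_self _ _ _
  have hfp : ∀ i ∈ f, p' i = p i := fun i hi => hold i (hF f hf i hi)
  have hNf : N ∉ f := fun hm => absurd (hF f hf N hm) (lt_irrefl _)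
  have hind := h.affIndepOn f hf
  have hseg : ∀ a ∈ f, ∀ q ∈ segment ℝ w (p a), q = p a ∨ q ∈ openTriangle p f := by
    intro a ha q hq
    obtain ⟨s, t, hs, ht, hst, h1, h2⟩ := exists_weight_of_mem_segment hc ha hq
    rcases eq_or_lt_of_le hs with rfl | hs
    · left
      have ht1 : t = 1 := by linarith
      simpa [ht1, ite_smul, ha] using h2
    · right
      exact ⟨_, fun i _ => by split_ifs <;> positivity, h1, h2⟩
  have hwT : w ∈ openTriangle p f :=
    ⟨fun _ => 1 / 3, fun _ _ => by norm_num, by rw [Finset.sum_const, hc]; norm_num, rfl⟩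
  have hvert : ∀ u < N, ∀ g ∈ F, p u ∉ openTriangle p g := by
    intro u hu g hg hm
    obtain ⟨v, huv⟩ := hdeg u hu
    exact Set.disjoint_left.1 (h.disjoint_edge g hg u v huv) hm (left_mem_segment _ _ _)
  have hold_new : ∀ u v, A u v → ∀ a ∈ f, ∀ q ∈ segment ℝ (p u) (p v), q ∈ segment ℝ w (p a) →
      q = p a := by
    intro u v huv a ha q hq hqa
    exact (hseg a ha q hqa).resolve_right fun hm =>
      Set.disjoint_left.1 (h.disjoint_edge f hf u v huv) hm hq
  have hnew_new : ∀ a ∈ f, ∀ b ∈ f, a ≠ b → ∀ q ∈ segment ℝ w (p a), q ∈ segment ℝ w (p b) →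
      q = w := by
    intro a ha b hb hab q hqa hqb
    obtain ⟨s, t, hs, ht, hst, h1, h2⟩ := exists_weight_of_mem_segment hc ha hqa
    obtain ⟨s', t', hs', ht', hst', h1', h2'⟩ := exists_weight_of_mem_segment hc hb hqb
    have key := hind.eq (h1.trans h1'.symm) (h2.symm.trans h2')
    have ka := key a ha
    have kb := key b hb
    simp only [if_true, if_neg hab, if_neg hab.symm] at ka kb
    have ht0 : t = 0 := by linarith
    have hs1 : s = 1 := by linarith
    rw [h2, hw, ht0, hs1]
    simp
  have hface_sub : ∀ x ∈ f, openTriangle p' (Insert.insert N (f.erase x)) ⊆ openTriangle p f := by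
    intro x hx q hq
    obtain ⟨ω, h0, h1, h2, -⟩ := exists_weight_of_mem_openTriangle hNf hc hfp hnew hx hq
    exact ⟨ω, h0, h1, h2⟩
  have hface_seg : ∀ x ∈ f, ∀ a ∈ f,
      Disjoint (openTriangle p' (Insert.insert N (f.erase x))) (segment ℝ w (p a)) := by
    intro x hx a ha
    rw [Set.disjoint_left]
    intro q hq hqa
    obtain ⟨ω, h0, h1, h2, h3⟩ := exists_weight_of_mem_openTriangle hNf hc hfp hnew hx hq
    obtain ⟨s, t, hs, ht, hst, h1', h2'⟩ := exists_weight_of_mem_segment hc ha hqa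
    have key := hind.eq (h1.trans h1'.symm) (h2.symm.trans h2')
    -- At a vertex `i` other than `a` and `x`, a point of the spoke to `a` has coordinate `s / 3`,
    -- no larger than its coordinate at `x`; but in the new triangle the coordinate at `x` is
    -- strictly the least.
    obtain ⟨i, hi, hia⟩ := Finset.exists_mem_notMem_of_card_lt_card
      (lt_of_le_of_lt (Finset.card_le_two (a := a) (b := x)) (by omega : 2 < f.card))
    simp only [Finset.mem_insert, Finset.mem_singleton, not_or] at hia
    have hlt := h3 i hi hia.2
    rw [key i hi, key x hx, if_neg hia.1] at hlt
    split_ifs at hlt <;> linarith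
  have hface_face : ∀ x ∈ f, ∀ y ∈ f, x ≠ y →
      Disjoint (openTriangle p' (Insert.insert N (f.erase x)))
        (openTriangle p' (Insert.insert N (f.erase y))) := by
    intro x hx y hy hxy
    rw [Set.disjoint_left]
    intro q hq hq'
    obtain ⟨ω, h0, h1, h2, h3⟩ := exists_weight_of_mem_openTriangle hNf hc hfp hnew hx hq
    obtain ⟨ω', h0', h1', h2', h3'⟩ := exists_weight_of_mem_openTriangle hNf hc hfp hnew hy hq'
    have key := hind.eq (h1.trans h1'.symm) (h2.symm.trans h2')
    have e1 := h3 y hy hxy.symm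
    have e2 := h3' x hx hxy
    rw [key x hx, key y hy] at e1
    linarith
  have hgp : ∀ g ∈ F, openTriangle p' g = openTriangle p g := fun g hg =>
    openTriangle_congr fun i hi => hold i (hF g hg i hi)
  have hgseg : ∀ g ∈ F, g ≠ f → ∀ a ∈ f, Disjoint (openTriangle p g) (segment ℝ w (p a)) := by
    intro g hg hgf a ha
    rw [Set.disjoint_left]
    intro q hq hqa
    rcases hseg a ha q hqa with rfl | hqf
    · exact hvert a (hF f hf a ha) g hg hq
    · exact Set.disjoint_left.1 (h.disjoint_face g hg f hf hgf) hq hqf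
  have hedge : ∀ u v, A u v ∨ (u = N ∧ v ∈ f) ∨ (v = N ∧ u ∈ f) →
      (A u v ∧ segment ℝ (p' u) (p' v) = segment ℝ (p u) (p v)) ∨
      ∃ a ∈ f, s(u, v) = s(N, a) ∧ segment ℝ (p' u) (p' v) = segment ℝ w (p a) := by
    rintro u v (huv | ⟨rfl, hv⟩ | ⟨rfl, hu⟩)
    · exact .inl ⟨huv, by rw [hold u (hA u v huv).1, hold v (hA u v huv).2]⟩
    · exact .inr ⟨v, hv, rfl, by rw [hnew, hfp v hv]⟩
    · exact .inr ⟨u, hu, Sym2.eq_swap, by rw [hnew, hfp u hu, segment_symm]⟩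
  have hcase : ∀ u < N + 1, u = N ∨ u < N := by omega
  refine ⟨p', ⟨⟨?_, ?_, ?_⟩, ?_, ?_, ?_⟩⟩
  · intro u hu v hv huv
    have hne : ∀ u < N, p u ≠ w := fun u hu he => hvert u hu f hf (he ▸ hwT)
    rcases hcase u hu with rfl | hu <;> rcases hcase v hv with rfl | hv
    · rfl
    · rw [hnew, hold v hv] at huv
      exact absurd huv.symm (hne v hv)
    · rw [hnew, hold u hu] at huv
      exact absurd huv (hne u hu)
    · rw [hold u hu, hold v hv] at huv
      exact h.inj u hu v hv huv
  · intro u v x huv hx hm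
    rcases hedge u v huv with ⟨huv, he⟩ | ⟨a, ha, hs, he⟩ <;> rw [he] at hm
    · rcases hcase x hx with hx' | hx
      · rw [hx', hnew] at hm
        exact absurd hm (Set.disjoint_left.1 (h.disjoint_edge f hf u v huv) hwT)
      · rw [hold x hx] at hm
        exact h.eq_or_eq u v x huv hx hm
    · rw [← Sym2.mem_iff, hs, Sym2.mem_iff]
      rcases hcase x hx with rfl | hx
      · exact .inl rfl
      · rw [hold x hx] at hm
        rcases hseg a ha _ hm with he | hm
        · exact .inr (h.inj x hx a (hF f hf a ha) he)
        · exact absurd hm (hvert x hx f hf)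
  · intro u v x y q huv hxy hne h1 h2
    rcases hedge u v huv with ⟨huv, he⟩ | ⟨a, ha, hs, he⟩ <;>
    rcases hedge x y hxy with ⟨hxy, he'⟩ | ⟨b, hb, hs', he'⟩ <;> rw [he] at h1 <;> rw [he'] at h2
    · obtain ⟨z, hz, rfl⟩ := h.noncrossing u v x y q huv hxy hne h1 h2
      exact ⟨z, by omega, (hold z hz).symm⟩
    · exact ⟨b, by have := hF f hf b hb; omega,
        (hold_new u v huv b hb q h1 h2).trans (hfp b hb).symm⟩
    · exact ⟨a, by have := hF f hf a ha; omega,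
        (hold_new x y hxy a ha q h2 h1).trans (hfp a ha).symm⟩
    · refine ⟨N, by omega, (hnew_new a ha b hb ?_ q h1 h2).trans hnew.symm⟩
      rintro rfl
      exact hne (hs.trans hs'.symm)
  · intro g hg
    rcases Finset.mem_union.1 hg with hg | hg
    · rw [Finset.mem_erase] at hg
      exact (h.affIndepOn g hg.2).congr fun i hi => hold i (hF g hg.2 i hi)
    · obtain ⟨x, hx, rfl⟩ := Finset.mem_image.1 hg
      exact hind.insert_erase hNf hc hfp hnew hx
  · intro g hg u v huv
    rcases Finset.mem_union.1 hg with hg | hg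
    · rw [Finset.mem_erase] at hg
      rw [hgp g hg.2]
      rcases hedge u v huv with ⟨huv, he⟩ | ⟨a, ha, hs, he⟩ <;> rw [he]
      · exact h.disjoint_edge g hg.2 u v huv
      · exact hgseg g hg.2 hg.1 a ha
    · obtain ⟨x, hx, rfl⟩ := Finset.mem_image.1 hg
      rcases hedge u v huv with ⟨huv, he⟩ | ⟨a, ha, hs, he⟩ <;> rw [he]
      · exact (h.disjoint_edge f hf u v huv).mono_left (hface_sub x hx)
      · exact hface_seg x hx a ha
  · intro g hg g' hg' hne
    rcases Finset.mem_union.1 hg with hg | hg <;> rcases Finset.mem_union.1 hg' with hg' | hg'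
    · rw [Finset.mem_erase] at hg hg'
      rw [hgp g hg.2, hgp g' hg'.2]
      exact h.disjoint_face g hg.2 g' hg'.2 hne
    · rw [Finset.mem_erase] at hg
      obtain ⟨x, hx, rfl⟩ := Finset.mem_image.1 hg'
      rw [hgp g hg.2]
      exact (h.disjoint_face g hg.2 f hf hg.1).mono_right (hface_sub x hx)
    · rw [Finset.mem_erase] at hg'
      obtain ⟨x, hx, rfl⟩ := Finset.mem_image.1 hg
      rw [hgp g' hg'.2]
      exact (h.disjoint_face f hf g' hg'.2 hg'.1.symm).mono_left (hface_sub x hx)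
    · obtain ⟨x, hx, rfl⟩ := Finset.mem_image.1 hg
      obtain ⟨y, hy, rfl⟩ := Finset.mem_image.1 hg'
      exact hface_face x hx y hy (by rintro rfl; exact hne rfl)

theorem isFaceDrawing_triangle {p : ℕ → Plane} (hp : AffIndepOn p {0, 1, 2}) :
    IsFaceDrawing 3 (fun u v => u < 3 ∧ v < 3 ∧ u ≠ v) {{0, 1, 2}} p := by
  have hmem : ∀ u < 3, u ∈ ({0, 1, 2} : Finset ℕ) := by decide
  have hsum : ∀ u < 3, ∀ v < 3, ∀ s t : ℝ,
      ∑ i ∈ ({0, 1, 2} : Finset ℕ), ((if i = u then s else 0) + if i = v then t else 0) = s + t ∧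
      ∑ i ∈ ({0, 1, 2} : Finset ℕ), ((if i = u then s else 0) + if i = v then t else 0) • p i =
        s • p u + t • p v := by
    intro u hu v hv s t
    simp only [add_smul, ite_smul, zero_smul]
    rw [Finset.sum_add_distrib, Finset.sum_add_distrib, Finset.sum_ite_eq', Finset.sum_ite_eq',
      Finset.sum_ite_eq', Finset.sum_ite_eq', if_pos (hmem u hu), if_pos (hmem v hv),
      if_pos (hmem u hu), if_pos (hmem v hv)]
    exact ⟨rfl, rfl⟩
  have key : ∀ u < 3, ∀ v < 3, ∀ x < 3, ∀ y < 3, ∀ s t s' t' : ℝ, s + t = 1 → s' + t' = 1 →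
      s • p u + t • p v = s' • p x + t' • p y → ∀ i < 3,
      ((if i = u then s else 0) + if i = v then t else 0) =
        (if i = x then s' else 0) + if i = y then t' else 0 := by
    intro u hu v hv x hx y hy s t s' t' h1 h2 h3 i hi
    refine hp.eq (ω := fun i => (if i = u then s else 0) + if i = v then t else 0)
      (ω' := fun i => (if i = x then s' else 0) + if i = y then t' else 0) ?_ ?_ i (hmem i hi)
    · rw [(hsum u hu v hv s t).1, (hsum x hx y hy s' t').1, h1, h2]
    · rw [(hsum u hu v hv s t).2, (hsum x hx y hy s' t').2, h3]
  refine ⟨⟨?_, ?_, ?_⟩, ?_, ?_, ?_⟩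
  · intro u hu v hv huv
    by_contra hne
    have := key u hu u hu v hv v hv 1 0 1 0 (by norm_num) (by norm_num) (by simp [huv]) u hu
    simp [hne] at this
  · rintro u v x ⟨hu, hv, huv⟩ hx ⟨s, t, hs, ht, hst, he⟩
    by_contra! hne
    have := key u hu v hv x hx x hx s t 1 0 hst (by norm_num) (by simp [he]) x hx
    simp [hne.1, hne.2] at this
  · rintro u v x y q ⟨hu, hv, huv⟩ ⟨hx, hy, hxy⟩ hne ⟨s, t, hs, ht, hst, rfl⟩ ⟨s', t', hs', ht', hst', he⟩
    have k := key u hu v hv x hx y hy s t s' t' hst hst' he.symm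
    by_cases hux : u = x ∨ u = y
    · have hv' : v ≠ x ∧ v ≠ y := by
        constructor <;> rintro rfl <;> rcases hux with rfl | rfl <;> simp_all [Sym2.eq_swap]
      have := k v hv
      simp [hv'.1, hv'.2, huv.symm] at this
      refine ⟨u, hu, ?_⟩
      have hs1 : s = 1 := by linarith
      simp [this, hs1]
    · push Not at hux
      have := k u hu
      simp [hux.1, hux.2, huv] at this
      refine ⟨v, hv, ?_⟩
      have hs1 : t = 1 := by linarith
      simp [this, hs1]
  · simpa using hp
  · simp only [Finset.mem_singleton, forall_eq]
    rintro u v ⟨hu, hv, huv⟩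
    rw [Set.disjoint_left]
    rintro q ⟨ω, hω, h1, h2⟩ ⟨s, t, hs, ht, hst, he⟩
    obtain ⟨i, hi, hiu, hiv⟩ : ∃ i < 3, i ≠ u ∧ i ≠ v := by
      have : ∀ u < 3, ∀ v < 3, ∃ i < 3, i ≠ u ∧ i ≠ v := by decide
      exact this u hu v hv
    have := hp.eq (ω := ω) (ω' := fun i => (if i = u then s else 0) + if i = v then t else 0)
      (by rw [(hsum u hu v hv s t).1, h1, hst]) (by rw [(hsum u hu v hv s t).2, he, h2]) i (hmem i hi)
    simp [hiu, hiv] at this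
    exact (hω i (hmem i hi)).ne' this
  · simp

theorem exists_affIndepOn : ∃ p : ℕ → Plane, AffIndepOn p {0, 1, 2} := by
  refine ⟨fun i => if i = 0 then 0 else if i = 1 then !₂[1, 0] else !₂[0, 1], fun ω hs h0 => ?_⟩
  have e0 := congrArg (fun q : Plane => q 0) h0
  have e1 := congrArg (fun q : Plane => q 1) h0
  simp at e0 e1 hs
  simp [e0, e1] at hs ⊢
  exact hs

theorem exists_stackAdj : ∀ {l : List (Finset ℕ)}, IsStack l → ∀ u < l.length + 4, ∃ v, StackAdj l u v
  | [], _, u, hu => ⟨if u = 0 then 1 else 0, by simp at hu; simp only [StackAdj]; split_ifs <;> omega⟩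
  | f :: l, hl, u, hu => by
    by_cases h : u < l.length + 4
    · obtain ⟨v, hv⟩ := exists_stackAdj hl.2 u h
      exact ⟨v, .inl hv⟩
    · have hp := stackFaces_props hl.2 f (Finset.mem_of_mem_erase hl.1)
      obtain ⟨v, hv⟩ : f.Nonempty := Finset.card_pos.1 (by omega)
      exact ⟨v, .inr (.inl ⟨by simp at hu; omega, hv⟩)⟩

theorem exists_isFaceDrawing : ∀ {l : List (Finset ℕ)}, IsStack l →
    ∃ p, IsFaceDrawing (l.length + 4) (StackAdj l) ((stackFaces l).erase {0, 1, 2}) p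
  | [], _ => by
    obtain ⟨p, hp⟩ := exists_affIndepOn
    -- The initial `K₄` is itself an insertion, of vertex `3` into the triangle `{0, 1, 2}`. This
    -- time the outer face is the one subdivided, so it drops out of the family.
    obtain ⟨p', h⟩ := (isFaceDrawing_triangle hp).insert (fun u v h => ⟨h.1, h.2.1⟩)
      (fun u hu => ⟨if u = 0 then 1 else 0, hu, by split_ifs <;> omega, by split_ifs <;> omega⟩)
      (by decide) (Finset.mem_singleton_self _) (by decide)
    refine ⟨p', ?_⟩
    have e1 : (fun u v => (u < 3 ∧ v < 3 ∧ u ≠ v) ∨ (u = 3 ∧ v ∈ ({0, 1, 2} : Finset ℕ)) ∨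
        (v = 3 ∧ u ∈ ({0, 1, 2} : Finset ℕ))) = StackAdj [] := by
      ext u v
      simp only [StackAdj, Finset.mem_insert, Finset.mem_singleton]
      omega
    have e2 : (({{0, 1, 2}} : Finset (Finset ℕ)).erase {0, 1, 2} ∪
        ({0, 1, 2} : Finset ℕ).image fun x => insert 3 (({0, 1, 2} : Finset ℕ).erase x)) =
        (stackFaces []).erase {0, 1, 2} := by decide
    rw [e1, e2] at h
    exact h
  | f :: l, hl => by
    obtain ⟨p, hp⟩ := exists_isFaceDrawing hl.2
    obtain ⟨p', h⟩ := hp.insert (fun u v h => ⟨(h.lt_and_ne hl.2).1, (h.lt_and_ne hl.2).2.1⟩)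
      (exists_stackAdj hl.2)
      (fun g hg => (stackFaces_props hl.2 g (Finset.mem_of_mem_erase hg)).2) hl.1
      (stackFaces_props hl.2 f (Finset.mem_of_mem_erase hl.1)).1
    have hsub : (stackFaces (f :: l)).erase {0, 1, 2} ⊆ ((stackFaces l).erase {0, 1, 2}).erase f ∪
        f.image fun x => insert (l.length + 4) (f.erase x) := by
      intro g hg
      rw [stackFaces, Finset.mem_erase, Finset.mem_union] at hg
      rw [Finset.mem_union]
      exact hg.2.imp_left fun hg' => by rw [Finset.mem_erase] at hg' ⊢; exact ⟨hg'.1, Finset.mem_erase.2 ⟨hg.1, hg'.2⟩⟩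
    exact ⟨p', ⟨h.toIsStraightDrawing, fun g hg => h.affIndepOn g (hsub hg),
      fun g hg => h.disjoint_edge g (hsub hg),
      fun g hg g' hg' => h.disjoint_face g (hsub hg) g' (hsub hg')⟩⟩

/-! ### Counting triangulations against placements -/

/-- The lists of length `k` describing a stacked triangulation on `k + 4` vertices. -/
def stackLists : ℕ → Finset (List (Finset ℕ))
  | 0 => {[]}
  | k + 1 => ((stackLists k).sigma fun l => (stackFaces l).erase {0, 1, 2}).image fun x => x.2 :: x.1

theorem isStack_of_mem_stackLists : ∀ {k : ℕ} {l : List (Finset ℕ)}, l ∈ stackLists k →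
    IsStack l ∧ l.length = k
  | 0, l, h => by
    rw [stackLists, Finset.mem_singleton] at h
    subst h
    exact ⟨trivial, rfl⟩
  | k + 1, l, h => by
    rw [stackLists, Finset.mem_image] at h
    obtain ⟨⟨l', f⟩, h, rfl⟩ := h
    rw [Finset.mem_sigma] at h
    have := isStack_of_mem_stackLists h.1
    exact ⟨⟨h.2, this.1⟩, by simp [this.2]⟩

/-- After `k` insertions there are `2 * k + 4` faces, all but the outer one available, and `2 * k +
3 ≥ 2 * (k + 1)`. -/
theorem two_pow_mul_factorial_le_card_stackLists (k : ℕ) : 2 ^ k * k.factorial ≤ (stackLists k).card := by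
  induction k with
  | zero => simp [stackLists]
  | succ k ih =>
    rw [stackLists, Finset.card_image_of_injective, Finset.card_sigma]
    · have : ∀ l ∈ stackLists k, ((stackFaces l).erase {0, 1, 2}).card = 2 * k + 3 := by
        intro l hl
        obtain ⟨h, rfl⟩ := isStack_of_mem_stackLists hl
        rw [Finset.card_erase_of_mem (outer_mem_stackFaces h), card_stackFaces h]
        omega
      rw [Finset.sum_congr rfl this, Finset.sum_const, smul_eq_mul, pow_succ, Nat.factorial_succ]
      calc 2 ^ k * 2 * ((k + 1) * k.factorial) = (2 ^ k * k.factorial) * (2 * (k + 1)) := by ring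
        _ ≤ _ := Nat.mul_le_mul ih (by omega)
    · rintro ⟨l, f⟩ ⟨l', f'⟩ h
      simp at h
      obtain ⟨rfl, rfl⟩ := h
      rfl

theorem isSimpleArc_segment {x y : Plane} (h : x ≠ y) : IsSimpleArc (segment ℝ x y) x y := by
  refine ⟨⟨⟨fun t => AffineMap.lineMap x y (t : ℝ), by fun_prop⟩, by simp, by simp⟩, ?_, ?_⟩
  · intro s t hst
    exact Subtype.ext (AffineMap.lineMap_injective ℝ h hst)
  · rw [segment_eq_image_lineMap]
    ext q
    simp

/-- The stacked triangulation as a graph. -/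
def stackGraph (l : List (Finset ℕ)) (n : ℕ) : SimpleGraph (Fin n) :=
  SimpleGraph.fromRel fun u v => StackAdj l u v

theorem stackGraph_adj {l : List (Finset ℕ)} (hl : IsStack l) {n : ℕ} {u v : Fin n} :
    (stackGraph l n).Adj u v ↔ StackAdj l u v := by
  rw [stackGraph, SimpleGraph.fromRel_adj]
  constructor
  · rintro ⟨-, h | h⟩
    · exact h
    · exact h.symm
  · exact fun h => ⟨fun e => (h.lt_and_ne hl).2.2 (congrArg _ e), .inl h⟩

theorem isPlanar_stackGraph {l : List (Finset ℕ)} (hl : IsStack l) :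
    IsPlanar (stackGraph l (l.length + 4)) := by
  obtain ⟨p, h⟩ := exists_isFaceDrawing hl
  refine ⟨fun v => p v, fun u v => segment ℝ (p u) (p v), ?_, ?_, ?_, ?_, ?_⟩
  · exact fun u v huv => Fin.ext (h.inj u u.2 v v.2 huv)
  · exact fun u v _ => segment_symm ℝ _ _
  · intro u v huv
    refine isSimpleArc_segment fun e => huv.ne (Fin.ext (h.inj u u.2 v v.2 e))
  · intro u v w huv hw
    simpa only [Fin.ext_iff] using h.eq_or_eq u v w ((stackGraph_adj hl).1 huv) w.2 hw
  · rintro u v w x huv hwx hne q ⟨h1, h2⟩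
    obtain ⟨y, hy, rfl⟩ := h.noncrossing u v w x q ((stackGraph_adj hl).1 huv)
      ((stackGraph_adj hl).1 hwx) (fun e => hne (Sym2.map.injective Fin.val_injective e)) h1 h2
    exact ⟨⟨y, hy⟩, rfl⟩

/-- Extension of a sequence of points by the origin. -/
noncomputable def extendPoints {n : ℕ} (p : Fin n → Plane) (i : ℕ) : Plane :=
  if h : i < n then p ⟨i, h⟩ else 0

theorem extendPoints_val {n : ℕ} (p : Fin n → Plane) (i : Fin n) : extendPoints p i = p i :=
  dif_pos i.2

theorem isStackDrawing_of_isPlaneDrawing {l : List (Finset ℕ)} (hl : IsStack l)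
    {p : Fin (l.length + 4) → Plane}
    (h : IsPlaneDrawing (stackGraph l (l.length + 4)) p fun u v => segment ℝ (p u) (p v)) :
    IsStackDrawing l (extendPoints p) where
  inj u hu v hv huv := by
    lift u to Fin (l.length + 4) using hu
    lift v to Fin (l.length + 4) using hv
    rw [extendPoints_val, extendPoints_val] at huv
    rw [h.injective huv]
  eq_or_eq u v w huv hw hm := by
    have := huv.lt_and_ne hl
    lift u to Fin (l.length + 4) using this.1
    lift v to Fin (l.length + 4) using this.2.1
    lift w to Fin (l.length + 4) using hw
    rw [extendPoints_val, extendPoints_val, extendPoints_val] at hm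
    simpa only [Fin.ext_iff] using h.vertex_of_mem_arc u v w ((stackGraph_adj hl).2 huv) hm
  noncrossing u v w x q huv hwx hne h1 h2 := by
    lift u to Fin (l.length + 4) using (huv.lt_and_ne hl).1
    lift v to Fin (l.length + 4) using (huv.lt_and_ne hl).2.1
    lift w to Fin (l.length + 4) using (hwx.lt_and_ne hl).1
    lift x to Fin (l.length + 4) using (hwx.lt_and_ne hl).2.1
    rw [extendPoints_val, extendPoints_val] at h1 h2
    obtain ⟨y, rfl⟩ := h.noncrossing u v w x ((stackGraph_adj hl).2 huv)
      ((stackGraph_adj hl).2 hwx) (fun e => hne (congrArg (Sym2.map Fin.val) e)) ⟨h1, h2⟩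
    exact ⟨y, y.2, (extendPoints_val p y).symm⟩

/-- A universal set carries at least as many labellings as there are stacked triangulations. -/
theorem two_pow_mul_factorial_le_descFactorial {k : ℕ} {X : Set Plane} [Fintype X]
    (hX : IsUniversalPointSet (k + 4) X) :
    2 ^ k * k.factorial ≤ (Fintype.card X).descFactorial (k + 4) := by
  have hex : ∀ l : stackLists k, ∃ e : Fin (k + 4) ↪ X,
      IsStackDrawing l (extendPoints fun i => (e i : Plane)) := by
    rintro ⟨l, hl⟩
    obtain ⟨h, rfl⟩ := isStack_of_mem_stackLists hl
    obtain ⟨p, hp, hd⟩ := hX _ (isPlanar_stackGraph h)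
    exact ⟨⟨fun v => ⟨p v, hp v⟩, fun u v huv => hd.injective (congrArg Subtype.val huv)⟩,
      isStackDrawing_of_isPlaneDrawing h hd⟩
  choose e he using hex
  have hinj : Function.Injective e := by
    rintro ⟨l, hl⟩ ⟨l', hl'⟩ hll
    have h := isStack_of_mem_stackLists hl
    have h' := isStack_of_mem_stackLists hl'
    have h1 := he ⟨l, hl⟩
    have h2 := he ⟨l', hl'⟩
    rw [← hll] at h2
    exact Subtype.ext (IsStackDrawing.eq_of_length_eq h.1 h'.1 h1 h2 (h.2.trans h'.2.symm))
  have := Fintype.card_le_of_injective e hinj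
  rw [Fintype.card_coe, Fintype.card_embedding_eq, Fintype.card_fin] at this
  exact (two_pow_mul_factorial_le_card_stackLists k).trans this

/-! ### Asymptotic estimates and conclusion -/

theorem two_pow_le_mul_choose {k m : ℕ}
    (h : 2 ^ k * k.factorial ≤ m.descFactorial (k + 4)) :
    2 ^ (k + 4) ≤ 16 * (k + 4) ^ 4 * m.choose (k + 4) := by
  rw [Nat.descFactorial_eq_factorial_mul_choose] at h
  have h1 : (k + 4).factorial ≤ (k + 4) ^ 4 * k.factorial := by
    rw [Nat.factorial_succ, Nat.factorial_succ, Nat.factorial_succ, Nat.factorial_succ]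
    calc (k + 3 + 1) * ((k + 2 + 1) * ((k + 1 + 1) * ((k + 1) * k.factorial)))
        ≤ (k + 4) * ((k + 4) * ((k + 4) * ((k + 4) * k.factorial))) :=
          Nat.mul_le_mul le_rfl (Nat.mul_le_mul (by omega) (Nat.mul_le_mul (by omega)
            (Nat.mul_le_mul_right _ (by omega))))
      _ = _ := by ring
  refine Nat.le_of_mul_le_mul_right (c := k.factorial) ?_ k.factorial_pos
  calc 2 ^ (k + 4) * k.factorial = 16 * (2 ^ k * k.factorial) := by ring
    _ ≤ 16 * ((k + 4) ^ 4 * k.factorial * m.choose (k + 4)) := 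
          Nat.mul_le_mul_left _ (h.trans (Nat.mul_le_mul_right _ h1))
    _ = _ := by ring

theorem choose_pow_le {m n : ℕ} (hm : 16 * m ≤ 17 * n) : m.choose n ^ 16 ≤ 64 ^ n := by
  -- This is a single term of the binomial expansion of `(8 + 1) ^ m`. The weight `8` suits a ratio
  -- `n / m` near `8 / 9`; here it suffices that `9 ^ 17 ≤ 8 ^ 18 = 8 ^ 16 * 64`.
  have h1 : 8 ^ n * m.choose n ≤ 9 ^ m := by
    rcases le_or_gt n m with h | h
    · have := add_pow 8 1 m
      norm_num at this
      rw [this]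
      exact Finset.single_le_sum (f := fun i => 8 ^ i * m.choose i) (fun _ _ => Nat.zero_le _)
        (Finset.mem_range.2 (by omega))
    · simp [Nat.choose_eq_zero_of_lt h]
  refine Nat.le_of_mul_le_mul_left (c := (8 ^ 16) ^ n) ?_ (by positivity)
  calc (8 ^ 16) ^ n * m.choose n ^ 16 = (8 ^ n * m.choose n) ^ 16 := by
        rw [mul_pow, ← pow_mul, ← pow_mul, mul_comm 16 n]
    _ ≤ (9 ^ m) ^ 16 := by gcongr
    _ = 9 ^ (16 * m) := by rw [← pow_mul, mul_comm]
    _ ≤ 9 ^ (17 * n) := by gcongr; norm_num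
    _ = (9 ^ 17) ^ n := by rw [pow_mul]
    _ ≤ (8 ^ 16 * 64) ^ n := by gcongr; norm_num
    _ = _ := mul_pow _ _ _

theorem eventually_lt_of_two_pow_le : ∀ᶠ n : ℕ in atTop, ∀ m : ℕ,
    2 ^ n ≤ 16 * n ^ 4 * m.choose n → 17 * n < 16 * m := by
  -- After taking 16th powers, `2 ^ 16` competes with `64 = 2 ^ 6`. The remaining factor `(2 ^ 10) ^
  -- n` outgrows the polynomial `16 ^ 16 * n ^ 64`.
  have h := tendsto_pow_const_div_const_pow_of_one_lt 64 (by norm_num : (1 : ℝ) < 2 ^ 10)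
  filter_upwards [h.eventually_lt_const (show (0 : ℝ) < (1 / 16 ^ 16) by positivity)] with n hn m hm
  by_contra! hcon
  have h2 : (2 ^ n) ^ 16 ≤ 16 ^ 16 * n ^ 64 * 64 ^ n := by
    calc (2 ^ n) ^ 16 ≤ (16 * n ^ 4 * m.choose n) ^ 16 := by gcongr
      _ = 16 ^ 16 * n ^ 64 * m.choose n ^ 16 := by ring
      _ ≤ _ := Nat.mul_le_mul_left _ (choose_pow_le hcon)
  have h3 : (2 ^ 10) ^ n ≤ 16 ^ 16 * n ^ 64 := by
    refine Nat.le_of_mul_le_mul_right (c := 64 ^ n) ?_ (by positivity)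
    calc (2 ^ 10) ^ n * 64 ^ n = (2 ^ n) ^ 16 := by
          rw [← mul_pow, ← pow_mul, mul_comm n, pow_mul]; norm_num
      _ ≤ _ := h2
  have h4 : ((2 : ℝ) ^ 10) ^ n ≤ 16 ^ 16 * (n : ℝ) ^ 64 := by exact_mod_cast h3
  rw [div_lt_div_iff₀ (by positivity) (by positivity)] at hn
  linarith

theorem corollary2 :
    ∃ ε : ℕ → ℝ, Tendsto ε atTop (𝓝 0) ∧
      ∀ n : ℕ, (((1.059 - ε n) * (n : ℝ) : ℝ) : EReal) ≤ ((minUniversalSize n : ENNReal) : EReal) := by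
  obtain ⟨N, hN⟩ := eventually_atTop.1 eventually_lt_of_two_pow_le
  -- For the finitely many small `n` the error `1.059` makes the bound trivial; the summand `4`
  -- ensures that `n` has the form `k + 4`.
  refine ⟨fun n => if N + 4 ≤ n then 0 else 1.059, ?_, fun n => ?_⟩
  · refine tendsto_const_nhds.congr' ?_
    filter_upwards [eventually_ge_atTop (N + 4)] with n hn
    rw [if_pos hn]
  · dsimp only
    split_ifs with hn
    swap
    · rw [sub_self, zero_mul]
      exact EReal.coe_ennreal_nonneg _
    have key : ((⌈1.059 * (n : ℝ)⌉₊ : ℕ) : ℕ∞) ≤ minUniversalSize n := by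
      refine le_iInf₂ fun X hX => ?_
      rcases X.finite_or_infinite with hfin | hinf
      · have := hfin.fintype
        rw [Set.encard_eq_coe_toFinset_card, Set.toFinset_card, Nat.cast_le, Nat.ceil_le]
        obtain ⟨k, rfl⟩ : ∃ k, n = k + 4 := ⟨n - 4, by omega⟩
        have := hN (k + 4) (by omega) _
          (two_pow_le_mul_choose (two_pow_mul_factorial_le_descFactorial hX))
        -- Since `17 / 16 = 1.0625`, this is stronger than the required bound.
        have : 17 * ((k + 4 : ℕ) : ℝ) < 16 * (Fintype.card X : ℝ) := by exact_mod_cast this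
        norm_num at this ⊢
        linarith
      · rw [hinf.encard_eq]
        exact le_top
    have h1 : (((⌈1.059 * (n : ℝ)⌉₊ : ℕ) : ENNReal) : EReal) ≤
        ((minUniversalSize n : ENNReal) : EReal) := by
      exact_mod_cast key
    refine le_trans ?_ h1
    rw [sub_zero]
    have h2 := EReal.coe_le_coe_iff.2 (Nat.le_ceil (1.059 * (n : ℝ)))
    rw [← ENNReal.ofReal_natCast, EReal.coe_ennreal_ofReal, max_eq_left (Nat.cast_nonneg _)]
    exact h2
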